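/- **Models.** Networks are finite simple undirected graphs $G=(V,E)$, $n=|V|$, whose nodes carry distinct natural numbers as identifiers, know $n$, and hold an input. Let $N_r(v)$ be the set of nodes within distance $r$ of $v$. *Polylogarithmic* means bounded by $C\log^{k}n$ for all $n\ge 2$, with constants $C,k$. - A deterministic SLOCAL algorithm of locality $t(n)$ processes the nodes one after the other in an arbitrary (adversarial) order. When $v$ is processed, it sees the subgraph induced by $N_{t(n)}(v)$ with the identifiers, inputs and current local memories of its nodes, and fills its own memory (which contains its output) by an arbitrary function of this and of $n$. A problem is in $\mathsf{P\text{-}SLOCAL}$ if such an algorithm, with $t$ polylogarithmic, solves every instance for all identifiers and all orders. - In a randomized LOCAL algorithm with $t(n)$ rounds, each node draws private random bits, and its output is an arbitrary function of $n$ and of the subgraph induced by $N_{t(n)}(v)$ with the identifiers, inputs and random bits of its nodes. A problem is in $\mathsf{P\text{-}RLOCAL}(\varepsilon(n))$ if such an algorithm, with $t$ polylogarithmic, solves every $n$-node instance, for all identifiers, with error probability at most $\varepsilon(n)$. **Problems.** A covering ILP is $\min\{c^{T}X : AX\ge b,\ X\in\mathbb{Z}_{\ge 0}^m\}$, and a packing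 ILP is $\max\{c^{T}X : AX\le b,\ X\in\mathbb{Z}_{\ge 0}^m\}$, where $A,b,c$ have nonnegative real entries. It is *distributed* over $G$ if every variable (with its weight $c_i$) and every constraint is held by a node, each node holding finitely many of them, and a constraint held by $v$ contains only variables held by $v$ or by neighbors of $v$. The weights are *polynomially bounded*: for fixed $C,k\in\mathbb{N}$, any two nonzero weights differ by a factor of at most $C n^{k}$. Instances are the feasible covering ILPs, respectively the packing ILPs with bounded objective, and every node has to output the values of its variables. An $\alpha$-approximation, $\alpha\ge 1$, is a feasible solution whose objective value is at most $\alpha$ times (covering), respectively at least $1/\alpha$ times (packing), the optimum. **Theorem.** Let $q:\mathbb{N}\to(0,\infty)$ be polylogarithmic and let $C,k\in\mathbb{N}$. The problem of computing a $\bigl(1+1/q(n)\bigr)$-approximation of a distributed covering ILP with weights polynomially bounded by $Cn^{k}$, and the same problem for packing ILPs, are in $\mathsf{P\text{-}SLOCAL}$, and hence also in $\mathsf{P\text{-}RLOCAL}(1/n^{c})$ for every constant $c>0$. -/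

import Mathlib

open scoped NNReal

/-! ### Distributed graph problems and views -/

/-- A distributed graph problem with node inputs in `I` and node outputs in `O`: which networks with
inputs are admissible instances, and which outputs solve a given instance. -/
structure GraphProblem (I O : Type) where
  Valid : ∀ (V : Type) [Fintype V], SimpleGraph V → (V → I) → Prop
  Sol : ∀ (V : Type) [Fintype V], SimpleGraph V → (V → I) → (V → O) → Prop

/-- The nodes within hop distance `r` of `v` (nodes in other components are never included). -/
def hopBall {V : Type} (G : SimpleGraph V) (v : V) (r : ℕ) : Set V :=
  {u | ∃ p : G.Walk v u, p.length ≤ r}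

/-- What a node can learn about a neighborhood: the identifier of the node itself, the identifiers
and labels of the nodes, and the edges (as pairs of identifiers). -/
structure View (L : Type) where
  center : ℕ
  nodes : Set (ℕ × L)
  edges : Set (ℕ × ℕ)

/-- The `r`-hop neighborhood of `v`, in the network `G` with identifiers `ident` and node
labels `lab`: the labelled subgraph induced by the nodes within distance `r` of `v`. -/
def viewAt {V L : Type} (G : SimpleGraph V) (ident : V → ℕ) (lab : V → L) (r : ℕ) (v : V) :
    View L where
  center := ident v
  nodes := {p | ∃ u ∈ hopBall G v r, p = (ident u, lab u)}
  edges := {e | ∃ u ∈ hopBall G v r, ∃ w ∈ hopBall G v r, G.Adj u w ∧ e = (ident u, ident w)}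

/-- `f(n) = log^{O(1)} n`. -/
def IsPolylog (f : ℕ → ℝ) : Prop :=
  ∃ C k : ℕ, ∀ n : ℕ, 2 ≤ n → f n ≤ C * Real.log n ^ k

/-! ### The SLOCAL model -/

/-- A deterministic SLOCAL algorithm with local memory contents in `S`. When a node is processed, it
sees its neighborhood, in which every node is labelled with its input and its memory (`none` for
a node not yet processed), and fills its own memory by an arbitrary function of the number
of nodes and of this view. The output of the node is part of the memory and is read off by `out`. -/
structure SLocalAlg (I S O : Type) where
  step : ℕ → View (I × Option S) → S
  out : S → O

open Classical in
/-- The memory contents after the nodes in the list `order` have been processed one after the other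
with locality `r`, starting from empty memories. -/
noncomputable def SLocalAlg.run {I S O V : Type} [Fintype V] (A : SLocalAlg I S O)
    (G : SimpleGraph V) (ident : V → ℕ) (x : V → I) (r : ℕ) (order : List V) : V → Option S :=
  order.foldl
    (fun σ v => Function.update σ v
      (some (A.step (Fintype.card V) (viewAt G ident (fun u => (x u, σ u)) r v))))
    (fun _ => none)

/-- `SLOCAL(t)`: the problems that have a deterministic SLOCAL algorithm of locality `t(n)` on
`n`-node networks, correct for all distinct identifiers and all orders of processing the nodes. -/
def SLOCAL (t : ℕ → ℕ) {I O : Type} : Set (GraphProblem I O) :=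
  {P | ∃ (S : Type) (A : SLocalAlg I S O),
    ∀ (V : Type) [Fintype V] (G : SimpleGraph V) (x : V → I), P.Valid V G x →
    ∀ ident : V → ℕ, Function.Injective ident →
    ∀ order : List V, order.Nodup → (∀ v, v ∈ order) →
      ∃ y : V → O,
        (∀ v, (A.run G ident x (t (Fintype.card V)) order v).map A.out = some (y v)) ∧
        P.Sol V G x y}

/-- `P-SLOCAL = SLOCAL(log^{O(1)} n)`. -/
def PSLOCAL {I O : Type} : Set (GraphProblem I O) :=
  {P | ∃ t : ℕ → ℕ, IsPolylog (fun n => (t n : ℝ)) ∧ P ∈ SLOCAL t}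

/-! ### The randomized LOCAL model -/

/-- A randomized (Monte Carlo) LOCAL algorithm. Every node of an `n`-node network privately draws
`bits n` fair coins. The output of a node after `r` rounds is an arbitrary function of `n` and of
the initial states (identifiers, inputs, coins) in its `r`-hop neighborhood. -/
structure RandLocalAlg (I O : Type) where
  bits : ℕ → ℕ
  out : (n : ℕ) → View (I × (Fin (bits n) → Bool)) → O

/-- The outputs after `r` rounds when the coins come out as `ρ`. -/
def RandLocalAlg.run {I O V : Type} [Fintype V] (A : RandLocalAlg I O)
    (G : SimpleGraph V) (ident : V → ℕ) (x : V → I) (r : ℕ)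
    (ρ : V → Fin (A.bits (Fintype.card V)) → Bool) : V → O :=
  fun v => A.out (Fintype.card V) (viewAt G ident (fun u => (x u, ρ u)) r v)

/-- `RLOCAL(t, ε)`: the problems that have a randomized `t(n)`-round LOCAL algorithm with error
probability at most `ε(n)` on `n`-node networks, for all distinct identifiers. All outcomes of the
(finitely many) coins are equally likely, so the probability is a ratio of cardinalities. -/
def RLOCAL (t : ℕ → ℕ) (ε : ℕ → ℝ) {I O : Type} : Set (GraphProblem I O) :=
  {P | ∃ A : RandLocalAlg I O,
    ∀ (V : Type) [Fintype V] (G : SimpleGraph V) (x : V → I), P.Valid V G x →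
    ∀ ident : V → ℕ, Function.Injective ident →
      (Set.ncard {ρ : V → Fin (A.bits (Fintype.card V)) → Bool |
          ¬ P.Sol V G x (A.run G ident x (t (Fintype.card V)) ρ)} : ℝ) ≤
        ε (Fintype.card V) * Nat.card (V → Fin (A.bits (Fintype.card V)) → Bool)}

/-- `P-RLOCAL(ε) = RLOCAL(log^{O(1)} n, ε)`. -/
def PRLOCAL (ε : ℕ → ℝ) {I O : Type} : Set (GraphProblem I O) :=
  {P | ∃ t : ℕ → ℕ, IsPolylog (fun n => (t n : ℝ)) ∧ P ∈ RLOCAL t ε}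

/-! ### Distributed covering and packing integer linear programs -/

/-- The part of a covering or packing ILP that is held by one node: the variables of the node (named
by natural numbers), their weights in the objective function (`weight` is only used on `vars`), and
the constraints of the node. A pair `(a, b)` is the constraint `∑ i, a i * X i ≥ b` in a
covering ILP, and `∑ i, a i * X i ≤ b` in a packing ILP. All numbers are nonnegative reals. -/
structure ILPPart where
  vars : Finset ℕ
  weight : ℕ → ℝ≥0
  cons : Finset ((ℕ →₀ ℝ≥0) × ℝ≥0)

/-- The left-hand side of a constraint. -/
def lhs (a : ℕ →₀ ℝ≥0) (X : ℕ → ℕ) : ℝ≥0 := ∑ i ∈ a.support, a i * (X i : ℝ≥0)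

/-- `X` (nonnegative integer values of the variables) satisfies all the covering constraints. -/
def CoveringFeasible {V : Type} (x : V → ILPPart) (X : ℕ → ℕ) : Prop :=
  ∀ v, ∀ p ∈ (x v).cons, p.2 ≤ lhs p.1 X

/-- `X` (nonnegative integer values of the variables) satisfies all the packing constraints. -/
def PackingFeasible {V : Type} (x : V → ILPPart) (X : ℕ → ℕ) : Prop :=
  ∀ v, ∀ p ∈ (x v).cons, lhs p.1 X ≤ p.2

/-- The value of the objective function. -/
noncomputable def objective {V : Type} [Fintype V] (x : V → ILPPart) (X : ℕ → ℕ) : ℝ≥0 :=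
  ∑ v, ∑ i ∈ (x v).vars, (x v).weight i * (X i : ℝ≥0)

open Classical in
/-- The values of the variables when every node `v` sets each of its own variables `i` to `y v i`. -/
noncomputable def assignment {V : Type} [Fintype V] (x : V → ILPPart) (y : V → ℕ → ℕ) : ℕ → ℕ :=
  fun i => ∑ v, if i ∈ (x v).vars then y v i else 0

/-- The parts `x` form an ILP distributed over the network `G`: every variable belongs to one node,
and a constraint of `v` contains only variables that belong to `v` or to neighbors of `v`. -/
structure IsDistributed {V : Type} (G : SimpleGraph V) (x : V → ILPPart) : Prop where
  owner_unique : ∀ u v i, i ∈ (x u).vars → i ∈ (x v).vars → u = v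
  constraint_local : ∀ v, ∀ p ∈ (x v).cons, ∀ i ∈ p.1.support,
    ∃ u, (u = v ∨ G.Adj v u) ∧ i ∈ (x u).vars

/-- Any two nonzero weights differ by a factor of at most `W`. -/
def WeightsBounded {V : Type} (x : V → ILPPart) (W : ℝ≥0) : Prop :=
  ∀ u v, ∀ i ∈ (x u).vars, ∀ j ∈ (x v).vars,
    (x v).weight j ≠ 0 → (x u).weight i ≤ W * (x v).weight j

/-- Computing an `α(n)`-approximation of a feasible distributed covering ILP (minimization) with
weights bounded by `W(n)`. Each node outputs the values of its variables. -/
noncomputable def coveringILP (α W : ℕ → ℝ≥0) : GraphProblem ILPPart (ℕ → ℕ) where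
  Valid := fun V _ G x => IsDistributed G x ∧ WeightsBounded x (W (Fintype.card V)) ∧
    ∃ X, CoveringFeasible x X
  Sol := fun V _ _ x y => CoveringFeasible x (assignment x y) ∧
    ∀ X, CoveringFeasible x X →
      objective x (assignment x y) ≤ α (Fintype.card V) * objective x X

/-- Computing an `α(n)`-approximation of a distributed packing ILP (maximization) with bounded
objective and with weights bounded by `W(n)`. Each node outputs the values of its variables. -/
noncomputable def packingILP (α W : ℕ → ℝ≥0) : GraphProblem ILPPart (ℕ → ℕ) where
  Valid := fun V _ G x => IsDistributed G x ∧ WeightsBounded x (W (Fintype.card V)) ∧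
    BddAbove (objective x '' {X | PackingFeasible x X})
  Sol := fun V _ _ x y => PackingFeasible x (assignment x y) ∧
    ∀ X, PackingFeasible x X →
      objective x X ≤ α (Fintype.card V) * objective x (assignment x y)

/-! ### Hop balls -/

section HopBall

variable {V : Type} {G : SimpleGraph V}

/-! Sequential ball growing serves both kinds of ILP. Measure a set `S` of nodes by `f S`, the
optimum of the ILP restricted to the constraints (covering) or to the variables (packing) held by
`S`; it depends only on the 1-neighborhood of `S`. A node `v` being processed considers the balls of
radius 1, 3, 5, ... around it, minus the nodes taken by earlier clusters. If some step multiplies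
`f` by at most `1 + 1/Q`, the smaller set becomes the inner cluster `C v` and the larger one the
outer cluster `D v`. If none of `L` steps does, the first set has value at most `OPT / (1 + 1/Q)^L`;
it becomes an outer cluster with empty inner cluster, and all such exceptions together amount to at
most `OPT/Q`.

The outer clusters partition the nodes, and the inner clusters have pairwise distance greater than
2, because `D v` absorbs all free nodes within distance 2 of `C v` (`clusterAlg_spec`). Moreover `∑
f (D v) ≤ (1 + 1/Q) ∑ f (C v) + OPT/Q` (`sum_clusters_le`).

Covering: add up optimal covers of the outer clusters. The total cost is at most `∑ f (D v)`, and `∑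
f (C v) ≤ OPT`, since separated inner clusters have constraints with disjoint variables
(`sum_coverOpt_le`). Packing: add up optimal packings of the inner clusters. Separation makes each
constraint meet only one of them (`packingFeasible_sum`), while `OPT ≤ ∑ f (D v)`
(`objective_le_sum_packOpt`).

The passage to randomized LOCAL works for every problem in `PSLOCAL` (`mem_PRLOCAL_of_mem_PSLOCAL`).
In each of `O(log n)` phases the nodes claim balls with radius `t` times a truncated geometric
variable, and every node is interior to a cluster with probability at least 3/8. Interior nodes of
one phase at distance at most `t` share a cluster. Hence, if the SLOCAL algorithm runs in the order
of phase and then identifier, dependencies within a phase stay inside one cluster, and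
polylogarithmic views determine all memories (`SimulatedRun.mem_eq_of_color_lt`). -/

theorem mem_hopBall_self (v : V) (r : ℕ) : v ∈ hopBall G v r := ⟨.nil, by simp⟩

theorem hopBall_mono (v : V) {r s : ℕ} (h : r ≤ s) : hopBall G v r ⊆ hopBall G v s :=
  fun _ ⟨p, hp⟩ => ⟨p, hp.trans h⟩

theorem mem_hopBall_comm {u v : V} {r : ℕ} : u ∈ hopBall G v r ↔ v ∈ hopBall G u r :=
  ⟨fun ⟨p, hp⟩ => ⟨p.reverse, by simpa using hp⟩, fun ⟨p, hp⟩ => ⟨p.reverse, by simpa using hp⟩⟩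

theorem mem_hopBall_trans {u v w : V} {r s : ℕ} (h₁ : u ∈ hopBall G v r)
    (h₂ : w ∈ hopBall G u s) : w ∈ hopBall G v (r + s) := by
  obtain ⟨p, hp⟩ := h₁
  obtain ⟨p', hp'⟩ := h₂
  exact ⟨p.append p', by rw [SimpleGraph.Walk.length_append]; omega⟩

theorem mem_hopBall_of_adj {u v : V} (h : G.Adj v u) : u ∈ hopBall G v 1 :=
  ⟨.cons h .nil, by simp⟩

theorem mem_hopBall_zero {u v : V} : u ∈ hopBall G v 0 ↔ u = v := by
  constructor
  · rintro ⟨p, hp⟩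
    exact (SimpleGraph.Walk.eq_of_length_eq_zero (Nat.le_zero.mp hp)).symm
  · rintro rfl
    exact mem_hopBall_self _ _

theorem mem_hopBall_succ {u v : V} {r : ℕ} :
    u ∈ hopBall G v (r + 1) ↔ u ∈ hopBall G v r ∨ ∃ w ∈ hopBall G v r, G.Adj w u := by
  constructor
  · rintro ⟨p, hp⟩
    -- Reversal turns the last edge of the walk into the first one, which `cases` can split off.
    rw [← p.reverse_reverse] at hp
    generalize p.reverse = q at hp
    cases q with
    | nil => exact .inl (mem_hopBall_self _ _)
    | @cons _ w _ h q =>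
      refine .inr ⟨w, ⟨q.reverse, ?_⟩, h.symm⟩
      simpa using hp
  · rintro (h | ⟨w, hw, h⟩)
    · exact hopBall_mono v (Nat.le_succ r) h
    · exact mem_hopBall_trans hw (mem_hopBall_of_adj h)

theorem mem_hopBall_one {u v : V} : u ∈ hopBall G v 1 ↔ u = v ∨ G.Adj v u := by
  rw [mem_hopBall_succ, mem_hopBall_zero]
  simp [mem_hopBall_zero]

end HopBall

/-! ### Views -/

section Views

variable {V V' L L' : Type} {G : SimpleGraph V} {G' : SimpleGraph V'} {ident : V → ℕ}
  {ident' : V' → ℕ} {lab : V → L} {lab' : V' → L} {v : V} {v' : V'} {R : ℕ}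

/-- A walk from `u` is copied edge by edge: the view lists its edges by identifiers, and injectivity
of `ident'` glues consecutive copies together. The bound `d + k ≤ R` keeps the walk inside the view.
-/
theorem exists_mem_hopBall_of_viewAt_eq (hi' : ident'.Injective)
    (h : viewAt G ident lab R v = viewAt G' ident' lab' R v') {u : V} {u' : V'} {d : ℕ}
    (hu : u ∈ hopBall G v d) (huu : ident' u' = ident u) {k : ℕ}
    (hk : d + k ≤ R) {w : V} (hw : w ∈ hopBall G u k) :
    ∃ w' ∈ hopBall G' u' k, ident' w' = ident w ∧ lab' w' = lab w := by
  have hn : (viewAt G ident lab R v).nodes ⊆ (viewAt G' ident' lab' R v').nodes := by rw [h]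
  have he : (viewAt G ident lab R v).edges ⊆ (viewAt G' ident' lab' R v').edges := by rw [h]
  have key : ∀ w ∈ hopBall G v R, ∀ b : V', ident' b = ident w → lab' b = lab w := by
    intro w hw b hb
    obtain ⟨c, -, hc⟩ := hn ⟨w, hw, rfl⟩
    simp only [Prod.mk.injEq] at hc
    have : b = c := hi' (hb.trans hc.1)
    rw [this, hc.2]
  induction k generalizing w with
  | zero =>
    rw [mem_hopBall_zero] at hw
    subst hw
    exact ⟨u', mem_hopBall_self _ _, huu, key _ (hopBall_mono _ (by omega) hu) _ huu⟩
  | succ k ih =>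
    rw [mem_hopBall_succ] at hw
    rcases hw with hw | ⟨p, hp, hpw⟩
    · obtain ⟨w', hw', h'⟩ := ih (by omega) hw
      exact ⟨w', hopBall_mono _ (Nat.le_succ k) hw', h'⟩
    · obtain ⟨p', hp', hpi, -⟩ := ih (by omega) hp
      have hpR : p ∈ hopBall G v R := hopBall_mono _ (by omega) (mem_hopBall_trans hu hp)
      have hwR : w ∈ hopBall G v R :=
        hopBall_mono _ (by omega)
          (mem_hopBall_trans (mem_hopBall_trans hu hp) (mem_hopBall_of_adj hpw))
      obtain ⟨a, -, b, -, hab, hid⟩ := he ⟨p, hpR, w, hwR, hpw, rfl⟩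
      simp only [Prod.mk.injEq] at hid
      obtain rfl : p' = a := hi' (hpi.trans hid.1)
      exact ⟨b, mem_hopBall_succ.mpr (.inr ⟨p', hp', hab⟩), hid.2.symm, key w hwR b hid.2.symm⟩

theorem viewAt_components_subset (hi' : ident'.Injective)
    (h : viewAt G ident lab R v = viewAt G' ident' lab' R v') {u : V} {u' : V'} {d r : ℕ}
    (hu : u ∈ hopBall G v d) (huu : ident' u' = ident u)
    (hr : d + r ≤ R) :
    (viewAt G ident lab r u).nodes ⊆ (viewAt G' ident' lab' r u').nodes ∧
      (viewAt G ident lab r u).edges ⊆ (viewAt G' ident' lab' r u').edges := by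
  have he : (viewAt G ident lab R v).edges ⊆ (viewAt G' ident' lab' R v').edges := by rw [h]
  constructor
  · rintro _ ⟨w, hw, rfl⟩
    obtain ⟨w', hw', h₁, h₂⟩ := exists_mem_hopBall_of_viewAt_eq hi' h hu huu hr hw
    exact ⟨w', hw', by rw [h₁, h₂]⟩
  · rintro _ ⟨a, ha, b, hb, hab, rfl⟩
    obtain ⟨a', ha', h₁, -⟩ := exists_mem_hopBall_of_viewAt_eq hi' h hu huu hr ha
    obtain ⟨b', hb', h₂, -⟩ := exists_mem_hopBall_of_viewAt_eq hi' h hu huu hr hb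
    obtain ⟨a₁, -, b₁, -, hab₁, hid⟩ := he ⟨a, hopBall_mono _ hr (mem_hopBall_trans hu ha), b,
      hopBall_mono _ hr (mem_hopBall_trans hu hb), hab, rfl⟩
    simp only [Prod.mk.injEq] at hid
    obtain rfl : a' = a₁ := hi' (h₁.trans hid.1)
    obtain rfl : b' = b₁ := hi' (h₂.trans hid.2)
    exact ⟨a', ha', b', hb', hab₁, by rw [h₁, h₂]⟩

/-- Equal views stay equal around corresponding nodes, with a correspondingly smaller radius. -/
theorem viewAt_eq_of_ident_eq (hi : ident.Injective) (hi' : ident'.Injective)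
    (h : viewAt G ident lab R v = viewAt G' ident' lab' R v') {u : V} {u' : V'} {d r : ℕ}
    (hu : u ∈ hopBall G v d) (hu' : u' ∈ hopBall G' v' d) (huu : ident' u' = ident u)
    (hr : d + r ≤ R) : viewAt G ident lab r u = viewAt G' ident' lab' r u' := by
  have h₁ := viewAt_components_subset hi' h hu huu hr
  have h₂ := viewAt_components_subset hi h.symm hu' huu.symm hr
  have h₃ : (viewAt G ident lab r u).center = (viewAt G' ident' lab' r u').center := huu.symm
  revert h₁ h₂ h₃
  generalize viewAt G ident lab r u = A
  generalize viewAt G' ident' lab' r u' = B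
  rintro ⟨h₁, h₂⟩ ⟨h₃, h₄⟩ h₅
  cases A
  cases B
  simp only [View.mk.injEq]
  exact ⟨h₅, h₁.antisymm h₃, h₂.antisymm h₄⟩

theorem ident_eq_of_viewAt_eq (h : viewAt G ident lab R v = viewAt G' ident' lab' R v') :
    ident' v' = ident v := (congrArg View.center h).symm

theorem lab_eq_of_viewAt_eq (hi' : ident'.Injective)
    (h : viewAt G ident lab R v = viewAt G' ident' lab' R v') : lab' v' = lab v := by
  obtain ⟨w', hw', -, hl⟩ := exists_mem_hopBall_of_viewAt_eq hi' h (mem_hopBall_self v 0)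
    (ident_eq_of_viewAt_eq h) (Nat.zero_le _) (mem_hopBall_self v 0)
  rwa [mem_hopBall_zero.mp hw'] at hl

theorem viewAt_mono (hi : ident.Injective) (hi' : ident'.Injective)
    (h : viewAt G ident lab R v = viewAt G' ident' lab' R v') {r : ℕ} (hr : r ≤ R) :
    viewAt G ident lab r v = viewAt G' ident' lab' r v' :=
  viewAt_eq_of_ident_eq hi hi' h (mem_hopBall_self v 0) (mem_hopBall_self v' 0)
    (ident_eq_of_viewAt_eq h) (by omega)

/-- Equal views remain equal when corresponding nodes are relabelled in the same way. -/
theorem viewAt_relabel (hi : ident.Injective) (hi' : ident'.Injective)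
    (h : viewAt G ident lab R v = viewAt G' ident' lab' R v') {l : V → L'} {l' : V' → L'}
    (hl : ∀ u ∈ hopBall G v R, ∀ u' ∈ hopBall G' v' R, ident' u' = ident u → l' u' = l u) :
    viewAt G ident l R v = viewAt G' ident' l' R v' := by
  have hc := ident_eq_of_viewAt_eq h
  have hE : (viewAt G ident l R v).edges = (viewAt G' ident' l' R v').edges :=
    (congrArg View.edges h :
      (viewAt G ident lab R v).edges = (viewAt G' ident' lab' R v').edges)
  have hN : (viewAt G ident l R v).nodes = (viewAt G' ident' l' R v').nodes := by
    apply Set.Subset.antisymm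
    · rintro _ ⟨u, hu, rfl⟩
      obtain ⟨u', hu', h₁, -⟩ := exists_mem_hopBall_of_viewAt_eq hi' h (mem_hopBall_self v 0)
        hc (by omega) hu
      exact ⟨u', hu', by rw [h₁, hl u hu u' hu' h₁]⟩
    · rintro _ ⟨u', hu', rfl⟩
      obtain ⟨u, hu, h₁, -⟩ := exists_mem_hopBall_of_viewAt_eq hi h.symm (mem_hopBall_self v' 0)
        hc.symm (by omega) hu'
      exact ⟨u, hu, by rw [h₁, hl u hu u' hu' h₁.symm]⟩
  revert hE hN
  have h₃ : (viewAt G ident l R v).center = (viewAt G' ident' l' R v').center := hc.symm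
  revert h₃
  generalize viewAt G ident l R v = A
  generalize viewAt G' ident' l' R v' = B
  intro h₁ h₂ h₃
  cases A
  cases B
  simp only [View.mk.injEq]
  exact ⟨h₁, h₃, h₂⟩

end Views

/-! ### Runs of SLOCAL algorithms -/

theorem List.idxOf_lt_idxOf_of_pairwise {α : Type} [DecidableEq α] {R : α → α → Prop} {l : List α}
    (hl : l.Pairwise R) {a b : α} (hb : b ∈ l) (h : l.idxOf a < l.idxOf b) : R a b := by
  have hb' := List.idxOf_lt_length_of_mem hb
  have := List.pairwise_iff_getElem.mp hl _ _ (h.trans hb') hb' h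
  simpa using this

section Run

variable {I S O V : Type} [Fintype V] (A : SLocalAlg I S O) (G : SimpleGraph V) (ident : V → ℕ)
  (x : V → I) (r : ℕ)

open Classical in
theorem SLocalAlg.run_append_singleton (l : List V) (a : V) :
    A.run G ident x r (l ++ [a]) = Function.update (A.run G ident x r l) a
      (some (A.step (Fintype.card V)
        (viewAt G ident (fun u => (x u, A.run G ident x r l u)) r a))) := by
  simp [SLocalAlg.run, List.foldl_append]

theorem SLocalAlg.run_of_not_mem (l : List V) {v : V} (h : v ∉ l) :
    A.run G ident x r l v = none := by
  classical
  induction l using List.reverseRecOn with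
  | nil => rfl
  | append_singleton l a ih =>
    simp only [List.mem_append, List.mem_singleton, not_or] at h
    rw [A.run_append_singleton, Function.update_of_ne h.2, ih h.1]

open Classical in
/-- When `v` is processed, it sees the final memories of the nodes before it in the order, and
empty memories of all other nodes. -/
theorem SLocalAlg.run_eq (l : List V) (hl : l.Nodup) {v : V} (hv : v ∈ l) :
    A.run G ident x r l v = some (A.step (Fintype.card V)
      (viewAt G ident
        (fun u => (x u, if l.idxOf u < l.idxOf v then A.run G ident x r l u else none)) r v)) := by
  induction l using List.reverseRecOn with
  | nil => simp at hv
  | append_singleton l a ih =>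
    rw [List.nodup_append] at hl
    have ha : a ∉ l := fun h => hl.2.2 a h a (by simp) rfl
    rw [A.run_append_singleton]
    by_cases hva : v = a
    · subst hva
      rw [Function.update_self]
      congr 4
      funext u
      congr 1
      rw [List.idxOf_append_of_notMem ha]
      by_cases hu : u ∈ l
      · have huv : u ≠ v := fun h => ha (h ▸ hu)
        have := List.idxOf_lt_length_of_mem hu
        rw [List.idxOf_append_of_mem hu, if_pos (by omega), Function.update_of_ne huv]
      · rw [List.idxOf_append_of_notMem hu, A.run_of_not_mem _ _ _ _ _ hu]
        by_cases huv : u = v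
        · subst huv
          simp
        · rw [Function.update_of_ne huv, A.run_of_not_mem _ _ _ _ _ hu, ite_self]
    · have hvl : v ∈ l := by simpa [hva] using hv
      rw [Function.update_of_ne hva, ih hl.1 hvl]
      congr 4
      funext u
      congr 1
      have hlt := List.idxOf_lt_length_of_mem hvl
      rw [List.idxOf_append_of_mem hvl]
      by_cases hu : u ∈ l
      · have hua : u ≠ a := fun h => ha (h ▸ hu)
        rw [List.idxOf_append_of_mem hu, Function.update_of_ne hua]
      · rw [List.idxOf_append_of_notMem hu, if_neg, if_neg (by omega)]
        have := List.idxOf_eq_length hu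
        omega

end Run

/-! ### Polylogarithmic functions -/

theorem isPolylog_of_le {f g : ℕ → ℝ} (hg : IsPolylog g) (h : ∀ n, 2 ≤ n → f n ≤ g n) :
    IsPolylog f := by
  obtain ⟨C, k, hC⟩ := hg
  exact ⟨C, k, fun n hn => (h n hn).trans (hC n hn)⟩

theorem isPolylog_const (a : ℝ) : IsPolylog fun _ => a :=
  ⟨⌈a⌉₊, 0, fun n _ => by simpa using Nat.le_ceil a⟩

theorem isPolylog_log : IsPolylog fun n => Real.log n := ⟨1, 1, fun n _ => by simp⟩

theorem half_le_log {n : ℕ} (hn : 2 ≤ n) : 1 / 2 ≤ Real.log n := by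
  have h := Real.log_two_gt_d9
  have : Real.log 2 ≤ Real.log n := Real.log_le_log (by norm_num) (by exact_mod_cast hn)
  linarith

theorem IsPolylog.add {f g : ℕ → ℝ} (hf : IsPolylog f) (hg : IsPolylog g) :
    IsPolylog fun n => f n + g n := by
  obtain ⟨C, k, hC⟩ := hf
  obtain ⟨D, l, hD⟩ := hg
  refine ⟨C * 2 ^ l + D * 2 ^ k, k + l, fun n hn => ?_⟩
  have h := half_le_log hn
  -- Since `2 * log n ≥ 1`, missing powers of `log n` can be padded in.
  have h1 : ∀ m : ℕ, 1 ≤ 2 ^ m * Real.log n ^ m := fun m => by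
    rw [← mul_pow]
    exact one_le_pow₀ (by linarith)
  have h0 : ∀ m : ℕ, 0 ≤ Real.log n ^ m := fun m => pow_nonneg (by linarith) m
  calc f n + g n ≤ C * Real.log n ^ k + D * Real.log n ^ l := add_le_add (hC n hn) (hD n hn)
    _ ≤ C * Real.log n ^ k * (2 ^ l * Real.log n ^ l)
        + D * Real.log n ^ l * (2 ^ k * Real.log n ^ k) :=
      add_le_add (le_mul_of_one_le_right (mul_nonneg (Nat.cast_nonneg _) (h0 _)) (h1 l))
        (le_mul_of_one_le_right (mul_nonneg (Nat.cast_nonneg _) (h0 _)) (h1 k))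
    _ = _ := by push_cast; ring

theorem IsPolylog.mul {f g : ℕ → ℝ} (hf : IsPolylog f) (hg : IsPolylog g) (hg0 : ∀ n, 0 ≤ g n) :
    IsPolylog fun n => f n * g n := by
  obtain ⟨C, k, hC⟩ := hf
  obtain ⟨D, l, hD⟩ := hg
  refine ⟨C * D, k + l, fun n hn => ?_⟩
  have h := half_le_log hn
  calc f n * g n ≤ (C * Real.log n ^ k) * (D * Real.log n ^ l) :=
        mul_le_mul (hC n hn) (hD n hn) (hg0 n)
          (mul_nonneg (Nat.cast_nonneg _) (pow_nonneg (by linarith) _))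
    _ = _ := by push_cast; ring

theorem isPolylog_clog : IsPolylog fun n => (Nat.clog 2 n : ℝ) := by
  refine isPolylog_of_le ((isPolylog_log.mul (isPolylog_const 2) (by simp)).add
    (isPolylog_const 1)) fun n hn => ?_
  have h2 := Real.log_two_gt_d9
  have hn0 : (1 : ℝ) < n := by exact_mod_cast hn
  have h1 : Nat.clog 2 n ≤ Nat.log 2 n + 1 := Nat.clog_le_of_le_pow (Nat.lt_pow_succ_log_self
    (by norm_num) n).le
  have h3 : (2 : ℝ) ^ Nat.log 2 n ≤ n := by exact_mod_cast Nat.pow_log_le_self 2 (by omega)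
  have h4 := Real.log_le_log (by positivity) h3
  rw [Real.log_pow] at h4
  have h5 : (Nat.clog 2 n : ℝ) ≤ Nat.log 2 n + 1 := by exact_mod_cast h1
  have h6 : (0 : ℝ) ≤ Nat.log 2 n := Nat.cast_nonneg _
  nlinarith

theorem isPolylog_ceil {f : ℕ → ℝ} (hf : IsPolylog f) (h0 : ∀ n, 0 ≤ f n) :
    IsPolylog fun n => (⌈f n⌉₊ : ℝ) :=
  isPolylog_of_le (hf.add (isPolylog_const 1)) fun n _ => (Nat.ceil_lt_add_one (h0 n)).le

/-! ### Random clusterings -/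

open Classical in
/-- The number of leading heads in a sequence of `B` coins. -/
noncomputable def heads {B : ℕ} (b : Fin B → Bool) : ℕ :=
  Nat.findGreatest (fun k => ∀ j : Fin B, (j : ℕ) < k → b j = true) B

theorem le_heads {B k : ℕ} {b : Fin B → Bool} :
    k ≤ heads b ↔ k ≤ B ∧ ∀ j : Fin B, (j : ℕ) < k → b j = true := by
  classical
  constructor
  · intro h
    refine ⟨h.trans (Nat.findGreatest_le B), fun j hj => ?_⟩
    exact Nat.findGreatest_spec (P := fun k => ∀ j : Fin B, (j : ℕ) < k → b j = true)
      (Nat.zero_le B) (fun j hj => absurd hj (Nat.not_lt_zero _)) j (hj.trans_le h)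
  · rintro ⟨h₁, h₂⟩
    exact Nat.le_findGreatest h₁ h₂

theorem heads_le {B : ℕ} (b : Fin B → Bool) : heads b ≤ B := (le_heads.mp le_rfl).1

theorem apply_heads {B : ℕ} {b : Fin B → Bool} (h : heads b < B) : b ⟨heads b, h⟩ = false := by
  by_contra hb
  have : heads b + 1 ≤ heads b := le_heads.mpr ⟨h, fun j hj => by
    rcases Nat.lt_succ_iff_lt_or_eq.mp hj with h' | h'
    · exact (le_heads.mp le_rfl).2 j h'
    · simpa [← h'] using hb⟩
  omega

section Clustering

variable {V : Type} (G : SimpleGraph V) (ident : V → ℕ) (t : ℕ) {B : ℕ} (β : V → Fin B → Bool)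

/-- The node `w` reaches all nodes within distance `t` times its number of leading heads; it is the
center of `y` if it has the largest identifier among the nodes that reach `y`. -/
def IsCenter (w y : V) : Prop :=
  y ∈ hopBall G w (t * heads (β w)) ∧ ∀ z, y ∈ hopBall G z (t * heads (β z)) → ident z ≤ ident w

/-- The node `y` has center `w`, and all nodes within distance `t` of `y` are reached by `w`. -/
def IsInterior (w y : V) : Prop :=
  IsCenter G ident t β w y ∧ 1 ≤ heads (β w) ∧ y ∈ hopBall G w (t * (heads (β w) - 1))

variable {G ident t β}

theorem IsCenter.unique (hi : ident.Injective) {w w' y : V} (h : IsCenter G ident t β w y)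
    (h' : IsCenter G ident t β w' y) : w = w' :=
  hi (le_antisymm (h'.2 w h.1) (h.2 w' h'.1))

theorem exists_isCenter [Finite V] (y : V) : ∃ w, IsCenter G ident t β w y := by
  obtain ⟨w, hw, h⟩ := Set.exists_max_image {w | y ∈ hopBall G w (t * heads (β w))} ident
    (Set.toFinite _) ⟨y, mem_hopBall_self _ _⟩
  exact ⟨w, hw, h⟩

/-- Interior nodes within distance `t` of each other have the same center. -/
theorem IsInterior.eq_of_mem_hopBall (hi : ident.Injective) {w w' y z : V}
    (h : IsInterior G ident t β w y) (h' : IsInterior G ident t β w' z) (hyz : z ∈ hopBall G y t) :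
    w = w' := by
  have key : ∀ {w w' y z : V}, IsInterior G ident t β w y → IsInterior G ident t β w' z →
      z ∈ hopBall G y t → ident w ≤ ident w' := by
    intro w w' y z h h' hyz
    refine h'.1.2 w (hopBall_mono _ ?_ (mem_hopBall_trans h.2.2 hyz))
    obtain ⟨k, hk⟩ := Nat.exists_eq_add_of_le h.2.1
    rw [hk, Nat.add_sub_cancel_left]
    exact le_of_eq (by ring)
  exact hi (le_antisymm (key h h' hyz) (key h' h (mem_hopBall_comm.mp hyz)))

open Classical in
/-- Turning the first tail of the center of `y` into heads makes `y` interior. -/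
theorem isInterior_update {w y : V} (h : IsCenter G ident t β w y) (hB : heads (β w) < B) :
    IsInterior G ident t
      (Function.update β w (Function.update (β w) ⟨heads (β w), hB⟩ true)) w y := by
  set β' := Function.update β w (Function.update (β w) ⟨heads (β w), hB⟩ true) with hβ'
  have hw : heads (β w) + 1 ≤ heads (β' w) := by
    rw [hβ', Function.update_self]
    refine le_heads.mpr ⟨hB, fun j hj => ?_⟩
    rcases Nat.lt_succ_iff_lt_or_eq.mp hj with h' | h'
    · rw [Function.update_of_ne (fun h => by simp [h] at h'), (le_heads.mp le_rfl).2 j h']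
    · have : j = ⟨heads (β w), hB⟩ := Fin.ext h'
      rw [this, Function.update_self]
  have hz : ∀ z, z ≠ w → β' z = β z := fun z hz => by rw [hβ', Function.update_of_ne hz]
  refine ⟨⟨hopBall_mono _ (Nat.mul_le_mul_left _ (by omega)) h.1, fun z hz' => ?_⟩, by omega,
    hopBall_mono _ (Nat.mul_le_mul_left _ (by omega)) h.1⟩
  by_cases hzw : z = w
  · rw [hzw]
  · rw [hz z hzw] at hz'
    exact h.2 z hz'

/-- Turning the first tail of the center of `y` into heads makes `y` interior. The change can be
undone: the center stays the same, and the position of the changed coin is determined because `y`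
was not interior before. -/
theorem ncard_not_interior_le_interior [Finite V] (hi : ident.Injective) (t B : ℕ) (y : V) :
    {β : V → Fin B → Bool | (¬ ∃ w, IsInterior G ident t β w y) ∧ ∀ w, heads (β w) < B}.ncard ≤
      {β : V → Fin B → Bool | ∃ w, IsInterior G ident t β w y}.ncard := by
  classical
  choose c hc using fun β : V → Fin B → Bool =>
    exists_isCenter (G := G) (ident := ident) (t := t) (β := β) y
  refine Set.ncard_le_ncard_of_injOn (fun β => if h : heads (β (c β)) < B then
    Function.update β (c β) (Function.update (β (c β)) ⟨heads (β (c β)), h⟩ true) else β)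
    ?_ ?_ (Set.toFinite _)
  · rintro β ⟨-, hβ⟩
    simp only [dif_pos (hβ (c β))]
    exact ⟨c β, isInterior_update (hc β) (hβ _)⟩
  · rintro β ⟨hn, hβ⟩ γ ⟨hn', hγ⟩ heq
    simp only [dif_pos (hβ (c β)), dif_pos (hγ (c γ))] at heq
    have h₁ := isInterior_update (hc β) (hβ (c β))
    have h₂ := isInterior_update (hc γ) (hγ (c γ))
    rw [heq] at h₁
    have hcc : c β = c γ := h₁.1.unique hi h₂.1
    -- If the common center had more heads in `γ` than in `β`, it would reach `y` in `γ` with a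
    -- margin of `t`, since it already reaches `y` in `β`; then `y` would be interior in `γ`.
    have key : ∀ {β γ : V → Fin B → Bool}, (¬ ∃ w, IsInterior G ident t γ w y) → c β = c γ →
        heads (γ (c γ)) ≤ heads (β (c β)) := by
      intro β γ hn' hcc
      by_contra! hlt
      refine hn' ⟨c γ, hc γ, by omega, ?_⟩
      have := (hc β).1
      rw [hcc] at this hlt
      exact hopBall_mono _ (Nat.mul_le_mul_left _ (by omega)) this
    have hk : heads (β (c β)) = heads (γ (c γ)) :=
      le_antisymm (key hn hcc.symm) (key hn' hcc)
    have hβ' := apply_heads (hβ (c β))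
    have hγ' := apply_heads (hγ (c γ))
    funext w j
    have hwj := congrFun (congrFun heq w) j
    by_cases hw : w = c β
    · have hw' : w = c γ := hw.trans hcc
      by_cases hj : (j : ℕ) = heads (β (c β))
      · have e₁ : j = ⟨heads (β (c β)), hβ (c β)⟩ := Fin.ext hj
        have e₂ : j = ⟨heads (γ (c γ)), hγ (c γ)⟩ := Fin.ext (hj.trans hk)
        have a₁ : β w j = false := by rw [hw, e₁]; exact hβ'
        have a₂ : γ w j = false := by rw [hw', e₂]; exact hγ'
        rw [a₁, a₂]
      · rw [← hw, ← hw'] at hwj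
        rw [← hw] at hj
        have hj' : (j : ℕ) ≠ heads (γ w) := by rw [hw', ← hk, ← hw]; exact hj
        simpa [Function.update_self, Function.update_of_ne, Fin.ext_iff, hj, hj'] using hwj
    · have hw' : w ≠ c γ := fun h => hw (h.trans hcc.symm)
      simpa [Function.update_of_ne hw, Function.update_of_ne hw'] using hwj

/-- If all coins of `w` are heads, they carry no information, so overwriting them by arbitrary coins
is injective. -/
theorem ncard_all_heads_le [Finite V] (w : V) (B : ℕ) :
    {β : V → Fin B → Bool | heads (β w) = B}.ncard * 2 ^ B ≤ Nat.card (V → Fin B → Bool) := by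
  classical
  rw [← Nat.card_coe_set_eq]
  have h2 : 2 ^ B = Nat.card (Fin B → Bool) := by simp
  rw [h2, ← Nat.card_prod]
  refine Nat.card_le_card_of_injective
    (fun p : {β : V → Fin B → Bool | heads (β w) = B} × (Fin B → Bool) =>
      Function.update p.1.1 w p.2) ?_
  rintro ⟨⟨β, hβ⟩, b⟩ ⟨⟨γ, hγ⟩, b'⟩ h
  simp only at h
  have hb : b = b' := by simpa using congrFun h w
  have hβγ : β = γ := by
    funext z
    by_cases hz : z = w
    · subst hz
      funext j
      rw [(le_heads.mp (Set.mem_ofPred.mp hβ).ge).2 j j.2,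
        (le_heads.mp (Set.mem_ofPred.mp hγ).ge).2 j j.2]
    · simpa [hz] using congrFun h z
  simp [hb, hβγ]

/-- Apart from the event that some node has only heads, of probability at most 1/4, failures inject
into successes. Hence twice the failure probability is at most `1 + 1/4`. -/
theorem ncard_not_interior_le [Fintype V] (hi : ident.Injective) (t B : ℕ)
    (hB : 4 * Fintype.card V ≤ 2 ^ B) (y : V) :
    8 * {β : V → Fin B → Bool | ¬ ∃ w, IsInterior G ident t β w y}.ncard ≤
      5 * Nat.card (V → Fin B → Bool) := by
  classical
  set N := {β : V → Fin B → Bool | ¬ ∃ w, IsInterior G ident t β w y}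
  set P := {β : V → Fin B → Bool | ∃ w, IsInterior G ident t β w y}
  set Q := {β : V → Fin B → Bool | (¬ ∃ w, IsInterior G ident t β w y) ∧ ∀ w, heads (β w) < B}
  set E := ⋃ w : V, {β : V → Fin B → Bool | heads (β w) = B}
  set T := Nat.card (V → Fin B → Bool)
  have hQ : Q.ncard ≤ P.ncard := ncard_not_interior_le_interior hi t B y
  have hNP : N.ncard + P.ncard = T := by
    have : P = Nᶜ := by ext; simp [N, P]
    rw [this]
    exact Set.ncard_add_ncard_compl N
  have hN : N.ncard ≤ Q.ncard + E.ncard := by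
    refine (Set.ncard_le_ncard (fun β hβ => ?_) (Set.toFinite _)).trans (Set.ncard_union_le Q E)
    by_cases h : ∀ w, heads (β w) < B
    · exact .inl ⟨hβ, h⟩
    · push Not at h
      obtain ⟨w, hw⟩ := h
      exact .inr (Set.mem_iUnion.mpr ⟨w, le_antisymm (heads_le _) hw⟩)
  have hE : E.ncard * 2 ^ B ≤ Fintype.card V * T := by
    have h₁ : E.ncard ≤ ∑ w : V, {β : V → Fin B → Bool | heads (β w) = B}.ncard :=
      Set.ncard_iUnion_le_of_fintype _
    calc E.ncard * 2 ^ B ≤ (∑ w : V, {β : V → Fin B → Bool | heads (β w) = B}.ncard) * 2 ^ B :=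
          Nat.mul_le_mul_right _ h₁
      _ = ∑ w : V, {β : V → Fin B → Bool | heads (β w) = B}.ncard * 2 ^ B := Finset.sum_mul ..
      _ ≤ ∑ _w : V, T := Finset.sum_le_sum fun w _ => ncard_all_heads_le w B
      _ = Fintype.card V * T := by simp
  have hE4 : 4 * E.ncard ≤ T := by
    have hn : 0 < Fintype.card V := Fintype.card_pos_iff.mpr ⟨y⟩
    refine Nat.le_of_mul_le_mul_left (c := Fintype.card V) ?_ hn
    calc Fintype.card V * (4 * E.ncard) = E.ncard * (4 * Fintype.card V) := by ring
      _ ≤ E.ncard * 2 ^ B := Nat.mul_le_mul_left _ hB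
      _ ≤ _ := hE
  omega

end Clustering

/-- The coins of a node, split into `K` phases with `B` coins each. -/
def phaseCoins {K B : ℕ} (b : Fin (K * B) → Bool) (p : ℕ) (j : Fin B) : Bool :=
  if h : p < K then b (finProdFinEquiv (⟨p, h⟩, j)) else false

/-- The phases use disjoint blocks of coins, which determine all coins; so the bad outcomes embed
into `K`-tuples from `N`. -/
theorem ncard_forall_phase_le {V : Type} [Finite V] (K B : ℕ) (N : Set (V → Fin B → Bool)) :
    {ρ : V → Fin (K * B) → Bool | ∀ p < K, (fun w => phaseCoins (ρ w) p) ∈ N}.ncard ≤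
      N.ncard ^ K := by
  have hN : N.ncard ^ K = Nat.card (Fin K → N) := by simp [Nat.card_pi]
  rw [hN, ← Nat.card_coe_set_eq]
  refine Nat.card_le_card_of_injective
    (fun ρ p => ⟨fun w => phaseCoins (ρ.1 w) p, ρ.2 p p.2⟩) ?_
  rintro ⟨ρ, hρ⟩ ⟨σ, hσ⟩ h
  simp only [Subtype.mk.injEq]
  funext w i
  have hp := congrFun h (finProdFinEquiv.symm i).1
  simp only [Subtype.mk.injEq] at hp
  have := congrFun (congrFun hp w) (finProdFinEquiv.symm i).2
  simpa [phaseCoins, -finProdFinEquiv_symm_apply] using this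

/-- With high probability, every node is interior in some phase. -/
theorem ncard_exists_not_interior_le {V : Type} [Fintype V] {G : SimpleGraph V} {ident : V → ℕ}
    (hi : ident.Injective) (t K B : ℕ) (hB : 4 * Fintype.card V ≤ 2 ^ B) :
    8 ^ K * {ρ : V → Fin (K * B) → Bool |
        ∃ y, ∀ p < K, ¬ ∃ w, IsInterior G ident t (fun w => phaseCoins (ρ w) p) w y}.ncard ≤
      Fintype.card V * (5 ^ K * Nat.card (V → Fin (K * B) → Bool)) := by
  have hT : Nat.card (V → Fin (K * B) → Bool) = Nat.card (V → Fin B → Bool) ^ K := by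
    simp only [Nat.card_fun, Nat.card_eq_fintype_card, Fintype.card_fin, Fintype.card_bool,
      Fintype.card_fun]
    rw [← pow_mul, ← pow_mul, ← pow_mul]
    congr 1
    ring
  have hU : {ρ : V → Fin (K * B) → Bool |
        ∃ y, ∀ p < K, ¬ ∃ w, IsInterior G ident t (fun w => phaseCoins (ρ w) p) w y} =
      ⋃ y : V, {ρ : V → Fin (K * B) → Bool | ∀ p < K, (fun w => phaseCoins (ρ w) p) ∈
        {β : V → Fin B → Bool | ¬ ∃ w, IsInterior G ident t β w y}} := by
    ext ρ
    simp
  rw [hU, hT, ← mul_pow]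
  calc _ ≤ 8 ^ K * ∑ y : V, {ρ : V → Fin (K * B) → Bool | ∀ p < K,
            (fun w => phaseCoins (ρ w) p) ∈
              {β : V → Fin B → Bool | ¬ ∃ w, IsInterior G ident t β w y}}.ncard :=
        Nat.mul_le_mul_left _ (Set.ncard_iUnion_le_of_fintype _)
    _ = ∑ y : V, 8 ^ K * _ := Finset.mul_sum ..
    _ ≤ ∑ _y : V, (5 * Nat.card (V → Fin B → Bool)) ^ K := by
        refine Finset.sum_le_sum fun y _ => ?_
        refine (Nat.mul_le_mul_left _ (ncard_forall_phase_le K B _)).trans ?_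
        rw [← mul_pow]
        exact Nat.pow_le_pow_left (ncard_not_interior_le hi t B hB y) K
    _ = _ := by simp

/-! ### Simulating SLOCAL algorithms in the randomized LOCAL model -/

/-- The first phase in which `y` is interior, where `b w p` are the coins of `w` in phase `p`. -/
noncomputable def color {V : Type} (G : SimpleGraph V) (ident : V → ℕ) (t : ℕ) {B : ℕ}
    (b : V → ℕ → Fin B → Bool) (y : V) : ℕ :=
  sInf {p | ∃ w, IsInterior G ident t (fun w => b w p) w y}

/-- The order in which the nodes are processed in the simulation: by color, then by identifier. -/
def Precedes {V : Type} (G : SimpleGraph V) (ident : V → ℕ) (t : ℕ) {B : ℕ}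
    (b : V → ℕ → Fin B → Bool) (u v : V) : Prop :=
  color G ident t b u < color G ident t b v ∨
    color G ident t b u = color G ident t b v ∧ ident u < ident v

open Classical in
/-- A network with inputs and coins in which every node is interior in one of the first `K` phases,
with the memories of a run of the SLOCAL step function `step`, and a distinguished node. -/
structure SimulatedRun (I S Λ : Type) (input : Λ → I) (B : ℕ) (coins : Λ → ℕ → Fin B → Bool)
    (t K : ℕ) (step : View (I × Option S) → S) where
  V : Type
  G : SimpleGraph V
  ident : V → ℕ
  ident_injective : ident.Injective
  lab : V → Λ
  exists_interior : ∀ y, ∃ p < K, ∃ w, IsInterior G ident t (fun w => coins (lab w) p) w y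
  mem : V → S
  mem_eq : ∀ v, mem v = step (viewAt G ident (fun u => (input (lab u),
    if Precedes G ident t (fun w => coins (lab w)) u v then some (mem u) else none)) t v)
  node : V

/-! ### Locality of clusters and colors. -/

section Locality

variable {V V' Λ : Type} {G : SimpleGraph V} {G' : SimpleGraph V'} {ident : V → ℕ}
  {ident' : V' → ℕ} {lab : V → Λ} {lab' : V' → Λ} {y : V} {y' : V'} {t B : ℕ}

/-- Every node that reaches `y` lies within `t * B` of it, as `heads` is at most `B`; so the whole
competition for the center of `y` is visible. -/
theorem exists_isInterior_of_viewAt_eq (hi : ident.Injective) (hi' : ident'.Injective)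
    (f : Λ → Fin B → Bool)
    (h : viewAt G ident lab (t * B) y = viewAt G' ident' lab' (t * B) y')
    (hw : ∃ w, IsInterior G ident t (fun w => f (lab w)) w y) :
    ∃ w', IsInterior G' ident' t (fun w => f (lab' w)) w' y' := by
  obtain ⟨w, ⟨h₁, h₂⟩, h₃, h₄⟩ := hw
  have hc := ident_eq_of_viewAt_eq h
  have hle : ∀ b : Fin B → Bool, t * heads b ≤ t * B := fun b => Nat.mul_le_mul_left _ (heads_le b)
  rw [mem_hopBall_comm] at h₄
  obtain ⟨w', hw', hid, hl⟩ := exists_mem_hopBall_of_viewAt_eq hi' h (mem_hopBall_self y 0) hc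
    ((Nat.zero_add _).trans_le ((Nat.mul_le_mul_left _ (Nat.sub_le _ _)).trans (hle _))) h₄
  rw [mem_hopBall_comm] at hw'
  refine ⟨w', ⟨hopBall_mono _ (Nat.mul_le_mul_left _ ?_) hw', fun z' hz' => ?_⟩, ?_, ?_⟩
  · simp only [hl]
    omega
  · rw [mem_hopBall_comm] at hz'
    obtain ⟨z, hz, hzid, hzl⟩ := exists_mem_hopBall_of_viewAt_eq hi h.symm (mem_hopBall_self y' 0)
      hc.symm ((Nat.zero_add _).trans_le (hle _)) hz'
    rw [← hzid, hid]
    refine h₂ z ?_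
    rw [mem_hopBall_comm]
    simpa only [hzl] using hz
  · simpa only [hl] using h₃
  · simpa only [hl] using hw'

theorem color_eq_of_viewAt_eq (hi : ident.Injective) (hi' : ident'.Injective)
    (coins : Λ → ℕ → Fin B → Bool)
    (h : viewAt G ident lab (t * B) y = viewAt G' ident' lab' (t * B) y') :
    color G' ident' t (fun w => coins (lab' w)) y' =
      color G ident t (fun w => coins (lab w)) y := by
  unfold color
  congr 1
  ext p
  exact ⟨exists_isInterior_of_viewAt_eq hi' hi (fun l => coins l p) h.symm,
    exists_isInterior_of_viewAt_eq hi hi' (fun l => coins l p) h⟩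

end Locality

/-! ### Evaluating the SLOCAL run from views. -/

section Simulation

variable {I S Λ : Type} {input : Λ → I} {B : ℕ} {coins : Λ → ℕ → Fin B → Bool} {t K : ℕ}
  {step : View (I × Option S) → S}

theorem SimulatedRun.exists_interior_color (N : SimulatedRun I S Λ input B coins t K step)
    (y : N.V) : ∃ w, IsInterior N.G N.ident t
      (fun w => coins (N.lab w) (color N.G N.ident t (fun w => coins (N.lab w)) y)) w y := by
  obtain ⟨p, -, hp⟩ := N.exists_interior y
  exact Nat.sInf_mem (s := {p | ∃ w, IsInterior N.G N.ident t (fun w => coins (N.lab w) p) w y})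
    ⟨p, hp⟩

theorem SimulatedRun.color_lt (N : SimulatedRun I S Λ input B coins t K step) (y : N.V) :
    color N.G N.ident t (fun w => coins (N.lab w)) y < K := by
  obtain ⟨p, hpK, hp⟩ := N.exists_interior y
  exact (Nat.sInf_le hp).trans_lt hpK

/-- The memory of a node of color less than `c` is determined by its view of radius
`c * (3 * (t * B) + t)`. -/
theorem SimulatedRun.mem_eq_of_color_lt (N N' : SimulatedRun I S Λ input B coins t K step) (c : ℕ)
    (v : N.V) (v' : N'.V) (hc : color N.G N.ident t (fun w => coins (N.lab w)) v < c)
    (h : viewAt N.G N.ident N.lab (c * (3 * (t * B) + t)) v =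
      viewAt N'.G N'.ident N'.lab (c * (3 * (t * B) + t)) v') :
    N.mem v = N'.mem v' := by
  induction c generalizing v v' with
  | zero => exact absurd hc (Nat.not_lt_zero _)
  | succ c ih =>
    have hi := N.ident_injective
    have hi' := N'.ident_injective
    set s := c * (3 * (t * B) + t) with hs
    have hs' : (c + 1) * (3 * (t * B) + t) = s + (3 * (t * B) + t) := by rw [hs]; ring
    rw [hs'] at h
    set col := color N.G N.ident t (fun w => coins (N.lab w)) with hcol
    set col' := color N'.G N'.ident t (fun w => coins (N'.lab w)) with hcol'
    have hvv := ident_eq_of_viewAt_eq h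
    rcases Nat.lt_succ_iff_lt_or_eq.mp hc with hc | hc
    · exact ih v v' hc (viewAt_mono hi hi' h (by omega))
    obtain ⟨w, hw⟩ := N.exists_interior_color v
    rw [← hcol, hc] at hw
    have hle : t * (heads (coins (N.lab w) c) - 1) ≤ t * B :=
      Nat.mul_le_mul_left _ ((Nat.sub_le _ _).trans (heads_le _))
    have hvw : w ∈ hopBall N.G v (t * B) := mem_hopBall_comm.mp (hopBall_mono _ hle hw.2.2)
    -- Inner induction on the identifier, inside the cluster of `w`, which lies within `2 * (t * B)`
    -- of `v`. A node `u` there keeps a view of radius `t * B + t + s`: `t` for what its step sees,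
    -- `t * B` for the colors of the nodes seen, and `s` for the memories of smaller color.
    have cluster : ∀ m, ∀ u, N.ident u = m → col u = c →
        IsInterior N.G N.ident t (fun w => coins (N.lab w) c) w u → u ∈ hopBall N.G v (2 * (t * B)) →
        ∀ u' ∈ hopBall N'.G v' (2 * (t * B)), N'.ident u' = N.ident u → N.mem u = N'.mem u' := by
      intro m
      induction m using Nat.strong_induction_on with
      | _ m ihm =>
        intro u hum huc huw hu u' hu' huu
        rw [N.mem_eq, N'.mem_eq]
        congr 1
        have hview := viewAt_eq_of_ident_eq hi hi' h hu hu' huu (r := t * B + t + s) (by omega)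
        have hcu : col' u' = col u := color_eq_of_viewAt_eq hi hi' coins
          (viewAt_mono hi hi' hview (by omega))
        refine viewAt_relabel hi hi' (viewAt_mono hi hi' hview (by omega)) fun z hz z' hz' hzz => ?_
        have hviewz := viewAt_eq_of_ident_eq hi hi' hview hz hz' hzz (r := t * B + s) (by omega)
        have hcz : col' z' = col z := color_eq_of_viewAt_eq hi hi' coins
          (viewAt_mono hi hi' hviewz (by omega))
        have hlab := lab_eq_of_viewAt_eq hi' hviewz
        have hiff : Precedes N'.G N'.ident t (fun w => coins (N'.lab w)) z' u' ↔
            Precedes N.G N.ident t (fun w => coins (N.lab w)) z u := by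
          unfold Precedes
          rw [← hcol, ← hcol', hcz, hcu, hzz, huu]
        rw [hlab]
        congr 1
        by_cases hp : Precedes N.G N.ident t (fun w => coins (N.lab w)) z u
        · rw [if_pos hp, if_pos (hiff.mpr hp)]
          congr 1
          symm
          rcases hp with hlt | ⟨heq, hlt⟩
          · exact ih z z' (huc ▸ hlt) (viewAt_mono hi hi' hviewz (by omega))
          · rw [← hcol, huc] at heq
            obtain ⟨w₂, hw₂⟩ := N.exists_interior_color z
            rw [← hcol, heq] at hw₂
            -- Interior nodes of the same phase within distance `t` share their center, so `z` is
            -- again in the cluster of `w`, with a smaller identifier.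
            obtain rfl := huw.eq_of_mem_hopBall hi hw₂ hz
            have hz2 : z ∈ hopBall N.G v (2 * (t * B)) := by
              rw [two_mul]
              exact mem_hopBall_trans hvw (hopBall_mono _ hle hw₂.2.2)
            obtain ⟨z₂, hz₂, hid, -⟩ := exists_mem_hopBall_of_viewAt_eq hi' h
              (mem_hopBall_self v 0) hvv (by omega) hz2
            obtain rfl : z₂ = z' := hi' (hid.trans hzz.symm)
            exact ihm _ (hum ▸ hlt) z rfl heq hw₂ hz2 z₂ hz₂ hzz
        · rw [if_neg hp, if_neg (mt hiff.mp hp)]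
    exact cluster _ v rfl hc hw (mem_hopBall_self _ _) v' (mem_hopBall_self _ _) hvv

/-- By `mem_eq_of_color_lt` the memory is one function of the view across all networks; this is the
rule that the LOCAL algorithm applies. Its value at views that do not occur is irrelevant. -/
theorem exists_view_function_of_simulatedRun (input : Λ → I) (coins : Λ → ℕ → Fin B → Bool)
    (t K : ℕ) (step : View (I × Option S) → S) :
    ∃ F : View Λ → S, ∀ N : SimulatedRun I S Λ input B coins t K step,
      F (viewAt N.G N.ident N.lab (K * (3 * (t * B) + t)) N.node) = N.mem N.node := by
  refine ⟨Function.extend (fun N : SimulatedRun I S Λ input B coins t K step =>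
    viewAt N.G N.ident N.lab (K * (3 * (t * B) + t)) N.node) (fun N => N.mem N.node)
    (fun _ => step ⟨0, ∅, ∅⟩), fun N => ?_⟩
  refine Function.FactorsThrough.extend_apply ?_ _ N
  intro N N' h
  exact N.mem_eq_of_color_lt N' K _ _ (N.color_lt _) h

end Simulation

theorem exists_sorted_list {V : Type} [Fintype V] (key : V → ℕ × ℕ) (hk : key.Injective) :
    ∃ l : List V, l.Nodup ∧ (∀ v, v ∈ l) ∧
      l.Pairwise fun u v => (key u).1 < (key v).1 ∨
        (key u).1 = (key v).1 ∧ (key u).2 < (key v).2 := by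
  classical
  let _ : LinearOrder V := LinearOrder.lift' (fun v => toLex (key v))
    (fun u v h => hk (by simpa using h))
  refine ⟨Finset.univ.sort (· ≤ ·), Finset.sort_nodup _ _, fun v => by simp, ?_⟩
  refine (Finset.sortedLT_sort Finset.univ).pairwise.imp fun {u v} h => ?_
  exact Prod.Lex.toLex_lt_toLex.mp h

/-- In the order by color and then identifier, being processed earlier is the relation `Precedes`,
so the memories of this actual SLOCAL run satisfy the recursion in `SimulatedRun`. -/
theorem exists_simulatedRun {I S O : Type} (A : SLocalAlg I S O) {V : Type} [Fintype V]
    (G : SimpleGraph V) (ident : V → ℕ) (hi : ident.Injective) {Λ : Type} (input : Λ → I) {B : ℕ}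
    (coins : Λ → ℕ → Fin B → Bool) (t K : ℕ) (lab : V → Λ)
    (hint : ∀ y, ∃ p < K, ∃ w, IsInterior G ident t (fun w => coins (lab w) p) w y) :
    ∃ l : List V, l.Nodup ∧ (∀ v, v ∈ l) ∧ ∃ mem : V → S,
      (∀ v, A.run G ident (fun v => input (lab v)) t l v = some (mem v)) ∧
      ∀ v, ∃ N : SimulatedRun I S Λ input B coins t K (A.step (Fintype.card V)),
        ∀ r, viewAt N.G N.ident N.lab r N.node = viewAt G ident lab r v ∧
          N.mem N.node = mem v := by
  classical
  obtain ⟨l, hl, hmem, hs⟩ := exists_sorted_list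
    (fun v => (color G ident t (fun w => coins (lab w)) v, ident v))
    (fun u v h => hi (congrArg Prod.snd h))
  refine ⟨l, hl, hmem, ?_⟩
  have hrun := fun v => A.run_eq G ident (fun v => input (lab v)) t l hl (hmem v)
  choose mem hm using fun v => (⟨_, hrun v⟩ : ∃ m, A.run G ident (fun v => input (lab v)) t l v = some m)
  refine ⟨mem, hm, fun v => ⟨⟨V, G, ident, hi, lab, hint, mem, fun v => ?_, v⟩, fun r => ⟨rfl, rfl⟩⟩⟩
  have h := hrun v
  rw [hm v, Option.some_inj] at h
  rw [h]
  congr 2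
  funext u
  congr 1
  have hiff : l.idxOf u < l.idxOf v ↔ Precedes G ident t (fun w => coins (lab w)) u v := by
    constructor
    · exact List.idxOf_lt_idxOf_of_pairwise hs (hmem v)
    · intro hp
      by_contra hlt
      rcases lt_or_eq_of_le (not_lt.mp hlt) with h' | h'
      · have h'' := List.idxOf_lt_idxOf_of_pairwise hs (hmem u) h'
        simp only at h''
        unfold Precedes at hp
        omega
      · rw [List.idxOf_inj (hmem v)] at h'
        subst h'
        unfold Precedes at hp
        omega
  rw [hm u]
  simp only [hiff]

/-- Every problem in `P-SLOCAL` can be solved with high probability in polylogarithmically many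
rounds in the randomized LOCAL model. -/
theorem mem_PRLOCAL_of_mem_PSLOCAL {I O : Type} {P : GraphProblem I O} (hP : P ∈ PSLOCAL) {c : ℝ}
    (hc : 0 < c) : P ∈ PRLOCAL (fun n => 1 / (n : ℝ) ^ c) := by
  obtain ⟨t, ht, S, A, hA⟩ := hP
  -- `B` ensures `2 ^ B ≥ 4 * n`, which the bound 5/8 needs. `K` ensures `n * (5/8) ^ K ≤ n ^ (-c)`
  -- for `n ≥ 1`, because `log (8/5) ≥ 1/3`.
  set B : ℕ → ℕ := fun n => Nat.clog 2 n + 2 with hBdef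
  set K : ℕ → ℕ := fun n => ⌈3 * (c + 1) * Real.log n⌉₊ with hKdef
  have hlog : ∀ n : ℕ, 0 ≤ 3 * (c + 1) * Real.log n := fun n =>
    mul_nonneg (by linarith) (Real.log_natCast_nonneg n)
  have hBpoly : IsPolylog fun n => (B n : ℝ) :=
    isPolylog_of_le (isPolylog_clog.add (isPolylog_const 2)) fun n _ => by simp [hBdef]
  have hKpoly : IsPolylog fun n => (K n : ℝ) :=
    isPolylog_ceil ((isPolylog_const (3 * (c + 1))).mul isPolylog_log
      (fun n => Real.log_natCast_nonneg n)) hlog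
  have hcoins : ∀ n, ∃ F : View (I × (Fin (K n * B n) → Bool)) → S,
      ∀ N : SimulatedRun I S (I × (Fin (K n * B n) → Bool)) Prod.fst (B n)
        (fun l => phaseCoins l.2) (t n) (K n) (A.step n),
        F (viewAt N.G N.ident N.lab (K n * (3 * (t n * B n) + t n)) N.node) = N.mem N.node :=
    fun n => exists_view_function_of_simulatedRun _ _ _ _ _
  choose F hF using hcoins
  refine ⟨fun n => K n * (3 * (t n * B n) + t n), ?_, ⟨fun n => K n * B n,
    fun n w => A.out (F n w)⟩, ?_⟩
  · refine isPolylog_of_le (hKpoly.mul (((isPolylog_const 3).mul (ht.mul hBpoly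
      fun n => Nat.cast_nonneg _) fun n => by positivity).add ht) fun n => by positivity)
      fun n _ => ?_
    push_cast
    rfl
  intro V _ G x hV ident hi
  set n := Fintype.card V with hn
  have hB : 4 * n ≤ 2 ^ B n := by
    have := Nat.le_pow_clog (b := 2) (by norm_num) n
    simp only [hBdef, pow_add]
    omega
  have hcount := ncard_exists_not_interior_le (G := G) hi (t n) (K n) (B n) hB
  -- If every node is interior in some phase, the outputs are those of a genuine SLOCAL run, hence
  -- correct.
  have hsub : {ρ : V → Fin (K n * B n) → Bool | ¬ P.Sol V G x
      (RandLocalAlg.run ⟨fun n => K n * B n, fun n w => A.out (F n w)⟩ G ident x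
        (K n * (3 * (t n * B n) + t n)) ρ)} ⊆ {ρ : V → Fin (K n * B n) → Bool |
        ∃ y, ∀ p < K n, ¬ ∃ w, IsInterior G ident (t n) (fun w => phaseCoins (ρ w) p) w y} := by
    intro ρ hρ
    by_contra hgood
    refine hρ ?_
    simp only [Set.mem_ofPred_eq] at hgood
    push Not at hgood
    obtain ⟨l, hl, hmem, mem, hrun, hsim⟩ := exists_simulatedRun A G ident hi Prod.fst
      (fun l => phaseCoins l.2) (t n) (K n) (fun u => (x u, ρ u)) hgood
    obtain ⟨y, hy, hsol⟩ := hA V G x hV ident hi l hl hmem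
    convert hsol using 1
    funext v
    obtain ⟨N, hN⟩ := hsim v
    have h := hy v
    rw [hrun v, Option.map_some, Option.some_inj] at h
    rw [← h, ← (hN 0).2, ← hF, (hN _).1]
    rfl
  have hle := Set.ncard_le_ncard hsub (Set.toFinite _)
  refine (Nat.cast_le.mpr hle).trans ?_
  rcases Nat.eq_zero_or_pos n with h0 | hpos
  · have : IsEmpty V := Fintype.card_eq_zero_iff.mp h0
    simp only [IsEmpty.exists_iff, Set.ofPred_false, Set.ncard_empty, Nat.cast_zero]
    positivity
  have hcountR : (8 : ℝ) ^ K n * ({ρ : V → Fin (K n * B n) → Bool |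
        ∃ y, ∀ p < K n, ¬ ∃ w, IsInterior G ident (t n) (fun w => phaseCoins (ρ w) p) w y}.ncard : ℝ)
      ≤ n * (5 ^ K n * Nat.card (V → Fin (K n * B n) → Bool)) := by exact_mod_cast hcount
  have hnR : (0 : ℝ) < n := by exact_mod_cast hpos
  have hpow : (n : ℝ) ^ (c + 1) * 5 ^ K n ≤ 8 ^ K n := by
    have h1 : (n : ℝ) ^ (c + 1) ≤ (8 / 5) ^ K n := by
      have hl85 : 1 / 3 ≤ Real.log (8 / 5) := by
        rw [div_le_iff₀ (by norm_num), mul_comm, ← Real.log_rpow (by norm_num)]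
        rw [Real.le_log_iff_exp_le (by positivity)]
        have := Real.exp_one_lt_d9
        norm_num
        linarith
      rw [← Real.log_le_log_iff (by positivity) (by positivity), Real.log_rpow hnR, Real.log_pow]
      have h2 : 3 * (c + 1) * Real.log n ≤ K n := Nat.le_ceil _
      nlinarith [Nat.cast_nonneg (α := ℝ) (K n)]
    rwa [div_pow, le_div_iff₀ (by positivity)] at h1
  rw [Real.rpow_add hnR, Real.rpow_one] at hpow
  have hc0 : (0 : ℝ) < (n : ℝ) ^ c := Real.rpow_pos_of_pos hnR c
  rw [div_mul_eq_mul_div, one_mul, le_div_iff₀ hc0]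
  set N : ℝ := ({ρ : V → Fin (K n * B n) → Bool |
        ∃ y, ∀ p < K n, ¬ ∃ w, IsInterior G ident (t n) (fun w => phaseCoins (ρ w) p) w y}.ncard : ℝ)
  set T : ℝ := (Nat.card (V → Fin (K n * B n) → Bool) : ℝ)
  have hpos5 : (0 : ℝ) < n * 5 ^ K n := by positivity
  refine le_of_mul_le_mul_left ?_ hpos5
  calc n * 5 ^ K n * (N * (n : ℝ) ^ c) = ((n : ℝ) ^ c * n * 5 ^ K n) * N := by ring
    _ ≤ 8 ^ K n * N := mul_le_mul_of_nonneg_right hpow (Nat.cast_nonneg _)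
    _ ≤ _ := hcountR
    _ = _ := by ring

/-! ### Ball growing in the SLOCAL model -/

/-- The identifiers of the nodes at distance at most `r` from the center, read off from a view. -/
def View.ball {L : Type} (w : View L) : ℕ → Set ℕ
  | 0 => {w.center}
  | r + 1 => w.ball r ∪ {b | ∃ a ∈ w.ball r, (a, b) ∈ w.edges}

theorem ball_viewAt {V L : Type} {G : SimpleGraph V} {ident : V → ℕ} (hi : ident.Injective)
    (lab : V → L) (v : V) {r R : ℕ} (h : r ≤ R) :
    (viewAt G ident lab R v).ball r = ident '' hopBall G v r := by
  induction r with
  | zero =>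
    ext a
    simp [View.ball, viewAt, mem_hopBall_zero, eq_comm]
  | succ r ih =>
    rw [View.ball, ih (by omega)]
    ext b
    constructor
    · rintro (⟨u, hu, rfl⟩ | ⟨_, ⟨u, hu, rfl⟩, a, ha, b', hb', hab, he⟩)
      · exact ⟨u, hopBall_mono _ (Nat.le_succ r) hu, rfl⟩
      · simp only [Prod.mk.injEq] at he
        obtain rfl := hi he.1
        exact ⟨b', mem_hopBall_succ.mpr (.inr ⟨u, hu, hab⟩), he.2.symm⟩
    · rintro ⟨u, hu, rfl⟩
      rcases mem_hopBall_succ.mp hu with hu' | ⟨w, hw, hwu⟩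
      · exact .inl ⟨u, hu', rfl⟩
      · exact .inr ⟨_, ⟨w, hw, rfl⟩, w, hopBall_mono _ (by omega) hw, u, hopBall_mono _ h hu,
          hwu, rfl⟩

open Classical in
/-- An inner and an outer cluster from a growing sequence of sets. If there is an index `j < L` at
which `g` grows by a factor of at most `a`, then the clusters are the sets number `j` and `j + 1`;
otherwise they are the empty set and the first set. -/
noncomputable def growCluster (g : Set ℕ → ℝ≥0) (a : ℝ≥0) (L : ℕ) (S : ℕ → Set ℕ) :
    Set ℕ × Set ℕ :=
  if h : ∃ j < L, g (S (j + 1)) ≤ a * g (S j) then (S h.choose, S (h.choose + 1)) else (∅, S 0)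

/-- In the second case `g` gains more than a factor `a` in each of `L` steps. -/
theorem growCluster_spec (g : Set ℕ → ℝ≥0) (a : ℝ≥0) (L : ℕ) (S : ℕ → Set ℕ) :
    (∃ j < L, (growCluster g a L S).1 = S j ∧ (growCluster g a L S).2 = S (j + 1) ∧
      g (S (j + 1)) ≤ a * g (S j)) ∨
    ((growCluster g a L S).1 = ∅ ∧ (growCluster g a L S).2 = S 0 ∧ a ^ L * g (S 0) ≤ g (S L)) := by
  unfold growCluster
  split_ifs with h
  · exact .inl ⟨h.choose, h.choose_spec.1, rfl, rfl, h.choose_spec.2⟩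
  · push Not at h
    refine .inr ⟨rfl, rfl, ?_⟩
    have key : ∀ j ≤ L, a ^ j * g (S 0) ≤ g (S j) := by
      intro j
      induction j with
      | zero => simp
      | succ j ih =>
        intro hj
        calc a ^ (j + 1) * g (S 0) = a * (a ^ j * g (S 0)) := by ring
          _ ≤ a * g (S j) := mul_le_mul_right (ih (by omega)) a
          _ ≤ _ := (h j hj).le
    exact key L le_rfl

/-- The memory of a node in the ball growing algorithm: its outer cluster (as a set of
identifiers), the values that it contributes to the variables, and its output. -/
structure ClusterMemory where
  cluster : Set ℕ
  contribution : ℕ → ℕ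
  output : ℕ → ℕ

/-- The labels of the nodes in a set, together with their identifiers. -/
def labelled {V I : Type} (ident : V → ℕ) (x : V → I) (T : Set V) : Set (ℕ × I) :=
  (fun u => (ident u, x u)) '' T

/-- The ball growing algorithm. A node grows a cluster among the nodes that are not yet in an outer
cluster, where the size of a set of nodes is measured by `f`, and chooses its contribution by `sol`.
The output is the sum of all the contributions seen. -/
noncomputable def clusterAlg {I : Type} (f : Set (ℕ × I) → Set ℕ → ℝ≥0)
    (sol : Set (ℕ × I) → Set ℕ → Set ℕ → ℕ → ℕ) (a : ℕ → ℝ≥0) (L : ℕ → ℕ) :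
    SLocalAlg I ClusterMemory (ℕ → ℕ) where
  step n w :=
    let N := {p | ∃ m, (p.1, (p.2, m)) ∈ w.nodes}
    -- The radii start at 1, so that once a node is processed, it and its neighbors all lie in outer
    -- clusters of processed nodes. They grow by 2, so that an outer cluster absorbs every free node
    -- within distance 2 of its inner cluster.
    let P := growCluster (f N) (a n) (L n)
      fun j => w.ball (2 * j + 1) \ {i | ∃ p ∈ w.nodes, ∃ m, p.2.2 = some m ∧ i ∈ m.cluster}
    ⟨P.2, sol N P.1 P.2, fun i =>
      sol N P.1 P.2 i + ∑ᶠ p ∈ w.nodes, p.2.2.elim 0 fun m => m.contribution i⟩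
  out m := m.output

/-- Disjoint outer clusters `D v` of radius `R` cover all nodes, and the inner clusters `C v ⊆ D v`
have pairwise distances greater than 2. -/
structure IsClustering {V : Type} (G : SimpleGraph V) (R : ℕ) (C D : V → Set V) : Prop where
  eq_of_mem : ∀ {u v w}, w ∈ D u → w ∈ D v → u = v
  exists_mem : ∀ w, ∃ u, w ∈ D u
  subset : ∀ v, C v ⊆ D v
  subset_hopBall : ∀ v, D v ⊆ hopBall G v R
  eq_of_mem_hopBall : ∀ {u v c c'}, c ∈ C u → c' ∈ C v → c' ∈ hopBall G c 2 → u = v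

/-- The last clause is why outputs can be fixed at once: a cluster that affects variable `i` meets
the 1-ball of `v`, and that ball is fully clustered when `v` has been processed, so nodes processed
later contribute nothing to `i`. -/
theorem clusterAlg_spec {I : Type} (f : Set (ℕ × I) → Set ℕ → ℝ≥0)
    (sol : Set (ℕ × I) → Set ℕ → Set ℕ → ℕ → ℕ) (a : ℕ → ℝ≥0) (Lf : ℕ → ℕ) {V : Type} [Fintype V]
    (G : SimpleGraph V) (x : V → I) (ident : V → ℕ) (hi : ident.Injective) (order : List V)
    (hnodup : order.Nodup) (horder : ∀ v, v ∈ order) {L r : ℕ} (hL : Lf (Fintype.card V) = L)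
    (hr : r = 4 * L + 3) :
    ∃ (C D : V → Set V) (y : V → ℕ → ℕ), IsClustering G (2 * L + 1) C D ∧
      (∀ v, ((clusterAlg f sol a Lf).run G ident x r order v).map (clusterAlg f sol a Lf).out =
        some (y v)) ∧
      (∀ v, f (labelled ident x (hopBall G v r)) (ident '' D v) ≤
          a (Fintype.card V) * f (labelled ident x (hopBall G v r)) (ident '' C v) ∨
        C v = ∅ ∧ ∃ S ⊆ hopBall G v (2 * L + 1),
          a (Fintype.card V) ^ L * f (labelled ident x (hopBall G v r)) (ident '' D v) ≤
            f (labelled ident x (hopBall G v r)) (ident '' S)) ∧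
      ∀ v i, (∀ u, sol (labelled ident x (hopBall G u r)) (ident '' C u) (ident '' D u) i ≠ 0 →
          ∃ w ∈ D u, w ∈ hopBall G v 1) →
        y v i = ∑ u, sol (labelled ident x (hopBall G u r)) (ident '' C u) (ident '' D u) i := by
  classical
  set A := clusterAlg f sol a Lf with hA
  have hrun := fun v => A.run_eq G ident x r order hnodup (horder v)
  choose mem hm using fun v => (⟨_, hrun v⟩ : ∃ m, A.run G ident x r order v = some m)
  set pos : V → ℕ := fun v => order.idxOf v with hpos
  have hpos_inj : ∀ {u v}, pos u = pos v → u = v := fun {u v} h => (List.idxOf_inj (horder u)).mp h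
  set N : V → Set (ℕ × I) := fun v => labelled ident x (hopBall G v r) with hN
  set H : V → Set ℕ := fun v => {i | ∃ u ∈ hopBall G v r, pos u < pos v ∧ i ∈ (mem u).cluster}
    with hH
  set P : V → Set ℕ × Set ℕ := fun v => growCluster (f (N v)) (a (Fintype.card V)) L
    fun j => ident '' hopBall G v (2 * j + 1) \ H v with hP
  have hmemP : ∀ v, (P v).2 = ident '' (ident ⁻¹' (P v).2) ∧
      (P v).1 = ident '' (ident ⁻¹' (P v).1) := by
    intro v
    have hS : ∀ j, (ident '' hopBall G v (2 * j + 1) \ H v) ⊆ Set.range ident := fun j =>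
      Set.sdiff_subset.trans (Set.image_subset_range _ _)
    rcases growCluster_spec (f (N v)) (a (Fintype.card V)) L
      (fun j => ident '' hopBall G v (2 * j + 1) \ H v) with ⟨j, -, h₁, h₂, -⟩ | ⟨h₁, h₂, -⟩
    · exact ⟨(Set.image_preimage_eq_of_subset (by simp only [hP, h₂]; exact hS _)).symm,
        (Set.image_preimage_eq_of_subset (by simp only [hP, h₁]; exact hS _)).symm⟩
    · exact ⟨(Set.image_preimage_eq_of_subset (by simp only [hP, h₂]; exact hS _)).symm,
        (Set.image_preimage_eq_of_subset (by simp only [hP, h₁]; exact Set.empty_subset _)).symm⟩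
  have hstep : ∀ v, mem v = ⟨(P v).2, sol (N v) (P v).1 (P v).2, fun i =>
      sol (N v) (P v).1 (P v).2 i +
        ∑ u, if u ∈ hopBall G v r ∧ pos u < pos v then (mem u).contribution i else 0⟩ := by
    intro v
    have h := hrun v
    rw [hm v, Option.some_inj] at h
    set σ : V → Option ClusterMemory := fun u => if pos u < pos v then some (mem u) else none
      with hσ
    have hlab : (fun u => (x u, if order.idxOf u < order.idxOf v then
        A.run G ident x r order u else none)) = fun u => (x u, σ u) := by
      funext u
      rw [hm u]
    rw [hlab] at h
    have hNv : {p : ℕ × I | ∃ m, (p.1, (p.2, m)) ∈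
        (viewAt G ident (fun u => (x u, σ u)) r v).nodes} = N v := by
      ext ⟨i, p⟩
      simp only [viewAt, hN, labelled, Set.mem_ofPred_eq, Set.mem_image, Prod.mk.injEq]
      constructor
      · rintro ⟨m, u, hu, rfl, rfl, -⟩
        exact ⟨u, hu, rfl, rfl⟩
      · rintro ⟨u, hu, rfl, rfl⟩
        exact ⟨σ u, u, hu, rfl, rfl, rfl⟩
    have hHv : {i | ∃ p ∈ (viewAt G ident (fun u => (x u, σ u)) r v).nodes,
        ∃ m, p.2.2 = some m ∧ i ∈ m.cluster} = H v := by
      ext i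
      constructor
      · rintro ⟨_, ⟨u, hu, rfl⟩, m, hum, him⟩
        simp only [hσ] at hum
        split_ifs at hum with hlt
        rw [Option.some_inj] at hum
        exact ⟨u, hu, hlt, hum ▸ him⟩
      · rintro ⟨u, hu, hlt, him⟩
        exact ⟨_, ⟨u, hu, rfl⟩, mem u, by simp [hσ, hlt], him⟩
    have hPv : growCluster (f (N v)) (a (Fintype.card V)) L (fun j =>
        (viewAt G ident (fun u => (x u, σ u)) r v).ball (2 * j + 1) \ H v) = P v := by
      -- Only the sets number 0 to `L` matter, so the balls need to be read off correctly only up to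
      -- radius `2 * L + 1`.
      have hgen : ∀ S S' : ℕ → Set ℕ, (∀ j ≤ L, S j = S' j) →
          growCluster (f (N v)) (a (Fintype.card V)) L S =
            growCluster (f (N v)) (a (Fintype.card V)) L S' := by
        intro S S' hS
        -- Stated as an equality of propositions, so that both sides choose the same index.
        have hiff : ∀ j, (j < L ∧ f (N v) (S (j + 1)) ≤ a (Fintype.card V) * f (N v) (S j)) =
            (j < L ∧ f (N v) (S' (j + 1)) ≤ a (Fintype.card V) * f (N v) (S' j)) := fun j => by
          by_cases hj : j < L
          · rw [hS j hj.le, hS (j + 1) hj]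
          · simp [hj]
        unfold growCluster
        simp only [hiff]
        split_ifs with h
        · rw [hS _ h.choose_spec.1.le, hS _ h.choose_spec.1]
        · rw [hS 0 (Nat.zero_le _)]
      exact hgen _ _ fun j hj => by rw [ball_viewAt hi _ _ (by omega)]
    have hsum : ∀ i, (∑ᶠ p ∈ (viewAt G ident (fun u => (x u, σ u)) r v).nodes,
        p.2.2.elim 0 fun m => m.contribution i) =
        ∑ u, if u ∈ hopBall G v r ∧ pos u < pos v then (mem u).contribution i else 0 := by
      intro i
      have himg : (viewAt G ident (fun u => (x u, σ u)) r v).nodes =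
          (fun u => (ident u, (x u, σ u))) '' hopBall G v r := by
        ext p
        simp only [viewAt, Set.mem_ofPred_eq, Set.mem_image, eq_comm]
      rw [himg, finsum_mem_image (fun u _ u' _ h => hi (congrArg Prod.fst h)), finsum_mem_def,
        finsum_eq_sum_of_fintype]
      refine Finset.sum_congr rfl fun u _ => ?_
      by_cases hu : u ∈ hopBall G v r <;> by_cases hlt : pos u < pos v <;>
        simp [Set.indicator, hu, hlt, hσ]
    rw [h]
    simp only [hA, clusterAlg, hNv, hHv, hL, hPv, hsum]
  have hcl : ∀ v, (mem v).cluster = (P v).2 := fun v => by rw [hstep v]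
  have hcontr : ∀ v, (mem v).contribution = sol (N v) (P v).1 (P v).2 := fun v => by rw [hstep v]
  set D : V → Set V := fun v => ident ⁻¹' (P v).2 with hD
  set C : V → Set V := fun v => ident ⁻¹' (P v).1 with hC
  have hmemS : ∀ v j w, ident w ∈ (ident '' hopBall G v (2 * j + 1) \ H v) ↔
      w ∈ hopBall G v (2 * j + 1) ∧ ident w ∉ H v := fun v j w => by
    rw [Set.mem_sdiff, hi.mem_set_image]
  have hspec : ∀ v, (∃ j < L, C v = {w | w ∈ hopBall G v (2 * j + 1) ∧ ident w ∉ H v} ∧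
      D v = {w | w ∈ hopBall G v (2 * (j + 1) + 1) ∧ ident w ∉ H v} ∧
        f (N v) (P v).2 ≤ a (Fintype.card V) * f (N v) (P v).1) ∨
      (C v = ∅ ∧ D v = {w | w ∈ hopBall G v (2 * 0 + 1) ∧ ident w ∉ H v} ∧
        a (Fintype.card V) ^ L * f (N v) (P v).2 ≤
          f (N v) (ident '' hopBall G v (2 * L + 1) \ H v)) := by
    intro v
    rcases growCluster_spec (f (N v)) (a (Fintype.card V)) L
      (fun j => ident '' hopBall G v (2 * j + 1) \ H v) with ⟨j, hj, h₁, h₂, h₃⟩ | ⟨h₁, h₂, h₃⟩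
    · refine .inl ⟨j, hj, ?_, ?_, ?_⟩
      · ext w
        simp only [hC, hP, h₁, Set.mem_preimage, hmemS, Set.mem_ofPred_eq]
      · ext w
        simp only [hD, hP, h₂, Set.mem_preimage, hmemS, Set.mem_ofPred_eq]
      · simp only [hP, h₁, h₂]
        exact h₃
    · refine .inr ⟨?_, ?_, ?_⟩
      · simp only [hC, hP, h₁, Set.preimage_empty]
      · ext w
        simp only [hD, hP, h₂, Set.mem_preimage, hmemS, Set.mem_ofPred_eq]
      · simp only [hP, h₂]
        exact h₃
  have hDball : ∀ v, D v ⊆ hopBall G v (2 * L + 1) := by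
    intro v w hw
    rcases hspec v with ⟨j, hj, -, h₂, -⟩ | ⟨-, h₂, -⟩ <;>
    · rw [h₂] at hw
      exact hopBall_mono _ (by omega) hw.1
  have hDH : ∀ v, ∀ w ∈ D v, ident w ∉ H v := by
    intro v w hw
    rcases hspec v with ⟨j, hj, -, h₂, -⟩ | ⟨-, h₂, -⟩ <;>
    · rw [h₂] at hw
      exact hw.2
  have hH_exists : ∀ {v w}, ident w ∈ H v → ∃ u, pos u < pos v ∧ w ∈ D u := by
    rintro v w ⟨u, -, hlt, hu⟩
    rw [hcl u] at hu
    exact ⟨u, hlt, hu⟩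
  -- The centers of intersecting outer clusters are within `4 * L + 2` of each other, so the later
  -- one sees and removes the cluster of the earlier one. This dictates the locality.
  have hdisj : ∀ {u v w}, w ∈ D u → w ∈ D v → ¬ pos u < pos v := by
    intro u v w hu hv hlt
    refine hDH v w hv ⟨u, hopBall_mono _ ?_ (mem_hopBall_trans (hDball v hv)
      (mem_hopBall_comm.mp (hDball u hu))), hlt, by rw [hcl u]; exact hu⟩
    omega
  have heq : ∀ {u v w}, w ∈ D u → w ∈ D v → u = v := fun {u v w} hu hv =>
    hpos_inj (le_antisymm (not_lt.mp (hdisj hv hu)) (not_lt.mp (hdisj hu hv)))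
  have hnear : ∀ v, ∀ w ∈ hopBall G v 1, ∃ u, pos u ≤ pos v ∧ w ∈ D u := by
    intro v w hw
    by_cases hwH : ident w ∈ H v
    · obtain ⟨u, hu, h⟩ := hH_exists hwH
      exact ⟨u, hu.le, h⟩
    · refine ⟨v, le_rfl, ?_⟩
      rcases hspec v with ⟨j, hj, -, h₂, -⟩ | ⟨-, h₂, -⟩ <;>
      · rw [h₂]
        exact ⟨hopBall_mono _ (by omega) hw, hwH⟩
  have hsub : ∀ v, C v ⊆ D v := by
    intro v w hw
    rcases hspec v with ⟨j, hj, h₁, h₂, -⟩ | ⟨h₁, -, -⟩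
    · rw [h₁] at hw
      rw [h₂]
      exact ⟨hopBall_mono _ (by omega) hw.1, hw.2⟩
    · rw [h₁] at hw
      exact hw.elim
  have hsep : ∀ {u v c c'}, c ∈ C u → c' ∈ C v → c' ∈ hopBall G c 2 → ¬ pos u < pos v := by
    intro u v c c' hc hc' hcc hlt
    -- As `c'` is within distance 2 of the inner cluster of `u`, it was either taken before or is
    -- absorbed by `D u`; either way the later cluster of `v` cannot contain it.
    have hx : ∃ z, pos z ≤ pos u ∧ c' ∈ D z := by
      by_cases hcH : ident c' ∈ H u
      · obtain ⟨z, hz, h⟩ := hH_exists hcH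
        exact ⟨z, hz.le, h⟩
      · refine ⟨u, le_rfl, ?_⟩
        rcases hspec u with ⟨j, hj, h₁, h₂, -⟩ | ⟨h₁, -, -⟩
        · rw [h₁] at hc
          rw [h₂]
          exact ⟨hopBall_mono _ (by omega) (mem_hopBall_trans hc.1 hcc), hcH⟩
        · rw [h₁] at hc
          exact hc.elim
    obtain ⟨z, hz, hzD⟩ := hx
    have := heq hzD (hsub v hc')
    subst this
    omega
  refine ⟨C, D, fun v => (mem v).output, ⟨heq, fun w => ?_, hsub, hDball, ?_⟩, ?_, ?_, ?_⟩
  · obtain ⟨u, -, hu⟩ := hnear w w (mem_hopBall_self _ _)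
    exact ⟨u, hu⟩
  · intro u v c c' hc hc' hcc
    exact hpos_inj (le_antisymm (not_lt.mp (hsep hc' hc (mem_hopBall_comm.mp hcc)))
      (not_lt.mp (hsep hc hc' hcc)))
  · intro v
    rw [hm v]
    rfl
  · intro v
    simp only [hD, hC]
    rw [← (hmemP v).1, ← (hmemP v).2]
    rcases hspec v with ⟨j, hj, -, -, h⟩ | ⟨h₁, -, h₃⟩
    · exact .inl h
    · refine .inr ⟨h₁, {w | w ∈ hopBall G v (2 * L + 1) ∧ ident w ∉ H v}, fun w hw => hw.1, ?_⟩
      convert h₃ using 2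
      ext i
      constructor
      · rintro ⟨w, hw, rfl⟩
        exact ⟨⟨w, hw.1, rfl⟩, hw.2⟩
      · rintro ⟨⟨w, hw, rfl⟩, hiH⟩
        exact ⟨w, ⟨hw, hiH⟩, rfl⟩
  · intro v i hvi
    simp only [hD, hC] at hvi ⊢
    simp only [← (hmemP _).1, ← (hmemP _).2] at hvi ⊢
    have hout : (mem v).output i = sol (N v) (P v).1 (P v).2 i +
        ∑ u, if u ∈ hopBall G v r ∧ pos u < pos v then (mem u).contribution i else 0 := by
      rw [hstep v]
    -- The term of `v` is split off on both sides: its memory is still empty while it sums, so its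
    -- own contribution was added separately.
    rw [hout, ← Finset.add_sum_erase _ _ (Finset.mem_univ v),
      ← Finset.add_sum_erase _ _ (Finset.mem_univ v)]
    simp only [lt_irrefl, and_false, if_false, zero_add]
    congr 1
    refine Finset.sum_congr rfl fun u hu => ?_
    rw [hcontr u]
    split_ifs with hcond
    · rfl
    · by_contra hne
      obtain ⟨w, hwD, hw⟩ := hvi u (Ne.symm hne)
      obtain ⟨z, hz, hzD⟩ := hnear v w hw
      obtain rfl := heq hwD hzD
      refine hcond ⟨hopBall_mono _ ?_ (mem_hopBall_trans hw (mem_hopBall_comm.mp (hDball _ hwD))),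
        lt_of_le_of_ne hz fun h => (Finset.ne_of_mem_erase hu) (hpos_inj h)⟩
      omega

/-! ### Parts of an integer linear program -/

/-- The contribution of the variables of a part to the objective function. -/
noncomputable def ILPPart.cost (p : ILPPart) (X : ℕ → ℕ) : ℝ≥0 :=
  ∑ i ∈ p.vars, p.weight i * (X i : ℝ≥0)

theorem objective_eq_sum_cost {V : Type} [Fintype V] (x : V → ILPPart) (X : ℕ → ℕ) :
    objective x X = ∑ v, (x v).cost X := rfl

/-- The contribution of a set of parts (with identifiers) to the objective function. -/
noncomputable def costOf (N : Set (ℕ × ILPPart)) (X : ℕ → ℕ) : ℝ≥0 := ∑ᶠ p ∈ N, p.2.cost X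

open Classical in
/-- The assignment `X` with all variables that do not satisfy `p` set to `0`. -/
noncomputable def zeroOutside (p : ℕ → Prop) (X : ℕ → ℕ) : ℕ → ℕ := fun i => if p i then X i else 0

theorem zeroOutside_of_pos {p : ℕ → Prop} {X : ℕ → ℕ} {i : ℕ} (h : p i) :
    zeroOutside p X i = X i := if_pos h

theorem zeroOutside_of_neg {p : ℕ → Prop} {X : ℕ → ℕ} {i : ℕ} (h : ¬ p i) :
    zeroOutside p X i = 0 := if_neg h

theorem zeroOutside_le (p : ℕ → Prop) (X : ℕ → ℕ) (i : ℕ) : zeroOutside p X i ≤ X i := by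
  unfold zeroOutside
  split_ifs <;> omega

theorem lhs_congr {a : ℕ →₀ ℝ≥0} {X Y : ℕ → ℕ} (h : ∀ i ∈ a.support, X i = Y i) :
    lhs a X = lhs a Y := Finset.sum_congr rfl fun i hi => by rw [h i hi]

theorem lhs_mono {a : ℕ →₀ ℝ≥0} {X Y : ℕ → ℕ} (h : ∀ i ∈ a.support, X i ≤ Y i) :
    lhs a X ≤ lhs a Y :=
  Finset.sum_le_sum fun i hi => mul_le_mul_right (Nat.cast_le.mpr (h i hi)) _

theorem ILPPart.cost_congr {p : ILPPart} {X Y : ℕ → ℕ} (h : ∀ i ∈ p.vars, X i = Y i) :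
    p.cost X = p.cost Y := Finset.sum_congr rfl fun i hi => by rw [h i hi]

theorem ILPPart.cost_mono {p : ILPPart} {X Y : ℕ → ℕ} (h : ∀ i ∈ p.vars, X i ≤ Y i) :
    p.cost X ≤ p.cost Y :=
  Finset.sum_le_sum fun i hi => mul_le_mul_right (Nat.cast_le.mpr (h i hi)) _

theorem ILPPart.cost_sum {ι : Type} (p : ILPPart) (s : Finset ι) (X : ι → ℕ → ℕ) :
    p.cost (fun i => ∑ u ∈ s, X u i) = ∑ u ∈ s, p.cost (X u) := by
  unfold ILPPart.cost
  rw [Finset.sum_comm]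
  exact Finset.sum_congr rfl fun i _ => by rw [Nat.cast_sum, Finset.mul_sum]

/-- Only finitely many objective values lie below any given bound. -/
theorem finite_weighted_sums_le {ι : Type} (s : Finset ι) (w : ι → ℝ≥0) (M : ℝ≥0) :
    {z | z ≤ M ∧ ∃ k : ι → ℕ, z = ∑ i ∈ s, w i * (k i : ℝ≥0)}.Finite := by
  classical
  induction s using Finset.induction_on with
  | empty =>
    refine (Set.finite_singleton (0 : ℝ≥0)).subset ?_
    rintro z ⟨-, k, rfl⟩
    simp
  | insert i s hi ih =>
    -- A term of weight 0 never changes the value; a positive weight forces `k i ≤ M / w i`.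
    by_cases hw : w i = 0
    · refine ih.subset ?_
      rintro z ⟨hz, k, rfl⟩
      refine ⟨hz, k, ?_⟩
      rw [Finset.sum_insert hi, hw, zero_mul, zero_add]
    · refine (Set.Finite.image2 (fun (m : ℕ) y => w i * (m : ℝ≥0) + y)
        (Set.finite_Iic ⌊M / w i⌋₊) ih).subset ?_
      rintro z ⟨hz, k, rfl⟩
      rw [Finset.sum_insert hi] at hz ⊢
      refine ⟨k i, ?_, _, ⟨le_trans le_add_self hz, k, rfl⟩, rfl⟩
      refine Nat.le_floor ?_
      rw [le_div_iff₀ (pos_iff_ne_zero.mpr hw), mul_comm]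
      exact le_trans le_self_add hz

theorem IsDistributed.exists_mem_hopBall_one {V : Type} {G : SimpleGraph V} {x : V → ILPPart}
    (hG : IsDistributed G x) {v : V}
    {p : (ℕ →₀ ℝ≥0) × ℝ≥0} (hp : p ∈ (x v).cons) {i : ℕ} (hi : i ∈ p.1.support) :
    ∃ u ∈ hopBall G v 1, i ∈ (x u).vars := by
  obtain ⟨u, hu, hiu⟩ := hG.constraint_local v p hp i hi
  exact ⟨u, mem_hopBall_one.mpr hu, hiu⟩

theorem mem_labelled_iff {V : Type} {x : V → ILPPart} {ident : V → ℕ} (hi : ident.Injective) {T : Set V} {v : V} {p : ILPPart} :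
    (ident v, p) ∈ labelled ident x T ↔ v ∈ T ∧ x v = p := by
  constructor
  · rintro ⟨u, hu, h⟩
    simp only [Prod.mk.injEq] at h
    obtain rfl := hi h.1
    exact ⟨hu, h.2⟩
  · rintro ⟨hv, rfl⟩
    exact ⟨v, hv, rfl⟩

section Parts

variable {V : Type} [Fintype V] {G : SimpleGraph V} {x : V → ILPPart} {ident : V → ℕ}

theorem finite_objective_values_le (x : V → ILPPart) (M : ℝ≥0) :
    {z | z ≤ M ∧ ∃ X, z = objective x X}.Finite := by
  refine (finite_weighted_sums_le (Finset.univ.sigma fun v => (x v).vars)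
    (fun p => (x p.1).weight p.2) M).subset ?_
  rintro z ⟨hz, X, rfl⟩
  exact ⟨hz, fun p => X p.2, by rw [objective, Finset.sum_sigma]⟩

/-- The weights are real, but only finitely many values lie below that of a given solution, so the
minimum is attained. -/
theorem exists_objective_minimal {p : (ℕ → ℕ) → Prop} (hp : ∃ X, p X) :
    ∃ X, p X ∧ ∀ Y, p Y → objective x X ≤ objective x Y := by
  obtain ⟨X₀, h₀⟩ := hp
  have hfin : {z | ∃ X, p X ∧ z = objective x X ∧ z ≤ objective x X₀}.Finite :=
    (finite_objective_values_le x (objective x X₀)).subset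
      fun z ⟨X, _, hz, hle⟩ => ⟨hle, X, hz⟩
  obtain ⟨_, ⟨X, hX, rfl, hle⟩, hmin⟩ := Set.exists_min_image _ id hfin ⟨_, X₀, h₀, rfl, le_rfl⟩
  refine ⟨X, hX, fun Y hY => ?_⟩
  by_cases h : objective x Y ≤ objective x X₀
  · exact hmin _ ⟨Y, hY, rfl, h⟩
  · exact hle.trans (not_le.mp h).le

theorem exists_objective_maximal {p : (ℕ → ℕ) → Prop} (hp : ∃ X, p X) {M : ℝ≥0}
    (hM : ∀ X, p X → objective x X ≤ M) :
    ∃ X, p X ∧ ∀ Y, p Y → objective x Y ≤ objective x X := by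
  obtain ⟨X₀, h₀⟩ := hp
  have hfin : {z | ∃ X, p X ∧ z = objective x X}.Finite :=
    (finite_objective_values_le x M).subset fun z ⟨X, hX, hz⟩ => ⟨hz ▸ hM X hX, X, hz⟩
  obtain ⟨_, ⟨X, hX, rfl⟩, hmax⟩ := Set.exists_max_image _ id hfin ⟨_, X₀, h₀, rfl⟩
  exact ⟨X, hX, fun Y hY => hmax _ ⟨Y, hY, rfl⟩⟩

open Classical in
theorem costOf_labelled (hi : ident.Injective) (T : Set V) (X : ℕ → ℕ) :
    costOf (labelled ident x T) X = ∑ v, if v ∈ T then (x v).cost X else 0 := by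
  rw [costOf, labelled, finsum_mem_image (fun u _ u' _ h => hi (congrArg Prod.fst h)),
    finsum_mem_def, finsum_eq_sum_of_fintype]
  rfl

theorem costOf_labelled_le (hi : ident.Injective) (T : Set V) (X : ℕ → ℕ) :
    costOf (labelled ident x T) X ≤ objective x X := by
  classical
  rw [costOf_labelled hi, objective_eq_sum_cost]
  exact Finset.sum_le_sum fun v _ => by split_ifs <;> simp

/-- If all the nonzero variables belong to `T`, then `T` contains all of the cost. -/
theorem costOf_labelled_eq (hi : ident.Injective) (hG : IsDistributed G x) {T : Set V} {X : ℕ → ℕ}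
    (h : ∀ i, X i ≠ 0 → ∃ u ∈ T, i ∈ (x u).vars) :
    costOf (labelled ident x T) X = objective x X := by
  classical
  rw [costOf_labelled hi, objective_eq_sum_cost]
  refine Finset.sum_congr rfl fun v _ => ?_
  split_ifs with hv
  · rfl
  · symm
    refine Finset.sum_eq_zero fun i hiv => ?_
    have : X i = 0 := by
      by_contra hne
      obtain ⟨u, hu, hiu⟩ := h i hne
      exact hv (hG.owner_unique u v i hiu hiv ▸ hu)
    simp [this]

open Classical in
theorem objective_zeroOutside (hG : IsDistributed G x) (T : Set V) (X : ℕ → ℕ) :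
    objective x (zeroOutside (fun i => ∃ u ∈ T, i ∈ (x u).vars) X) =
      ∑ v, if v ∈ T then (x v).cost X else 0 := by
  rw [objective_eq_sum_cost]
  refine Finset.sum_congr rfl fun v _ => ?_
  split_ifs with hv
  · exact ILPPart.cost_congr fun i hiv => zeroOutside_of_pos ⟨v, hv, hiv⟩
  · refine Finset.sum_eq_zero fun i hiv => ?_
    rw [zeroOutside_of_neg, Nat.cast_zero, mul_zero]
    rintro ⟨u, hu, hiu⟩
    exact hv (hG.owner_unique u v i hiu hiv ▸ hu)

theorem objective_sum (x : V → ILPPart) {ι : Type} (s : Finset ι) (X : ι → ℕ → ℕ) :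
    objective x (fun i => ∑ u ∈ s, X u i) = ∑ u ∈ s, objective x (X u) := by
  simp only [objective_eq_sum_cost, ILPPart.cost_sum]
  exact Finset.sum_comm

theorem assignment_eq (hG : IsDistributed G x) (y : V → ℕ → ℕ) {v : V} {i : ℕ}
    (hi : i ∈ (x v).vars) : assignment x y i = y v i := by
  classical
  rw [assignment, Finset.sum_eq_single v, if_pos hi]
  · intro u _ huv
    exact if_neg fun hu => huv (hG.owner_unique u v i hu hi)
  · simp

end Parts

/-- Summing up the sizes of the clusters of the ball growing algorithm. -/
theorem sum_clusters_le {V : Type} [Fintype V] (F : Set V → ℝ≥0) (C D : V → Set V)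
    {a δ opt : ℝ≥0} {L : ℕ} (hF : ∀ S, F S ≤ opt) (ha : 0 < a)
    (hL : (Fintype.card V : ℝ≥0) ≤ δ * a ^ L)
    (h : ∀ v, F (D v) ≤ a * F (C v) ∨ C v = ∅ ∧ ∃ S, a ^ L * F (D v) ≤ F S) :
    ∑ v, F (D v) ≤ a * ∑ v, F (C v) + δ * opt := by
  have haL : 0 < a ^ L := pow_pos ha L
  -- A common bound for both cases; the exceptional term is paid at most once per node.
  have h1 : ∀ v, F (D v) ≤ a * F (C v) + opt / a ^ L := by
    intro v
    rcases h v with h | ⟨-, S, hS⟩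
    · exact h.trans le_self_add
    · refine le_trans ?_ le_add_self
      rw [le_div_iff₀ haL, mul_comm]
      exact hS.trans (hF S)
  calc ∑ v, F (D v) ≤ ∑ v, (a * F (C v) + opt / a ^ L) := Finset.sum_le_sum fun v _ => h1 v
    _ = a * ∑ v, F (C v) + Fintype.card V * (opt / a ^ L) := by
      rw [Finset.sum_add_distrib, ← Finset.mul_sum]
      simp
    _ ≤ _ := by
      refine add_le_add le_rfl ?_
      rw [mul_div_assoc', div_le_iff₀ haL]
      calc _ ≤ δ * a ^ L * opt := mul_le_mul_left hL _
        _ = _ := by ring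

/-! ### Covering integer linear programs -/

/-- `X` satisfies the covering constraints held by the nodes with identifiers in `S`. -/
def CoversOn (N : Set (ℕ × ILPPart)) (S : Set ℕ) (X : ℕ → ℕ) : Prop :=
  ∀ p ∈ N, p.1 ∈ S → ∀ c ∈ p.2.cons, c.2 ≤ lhs c.1 X

/-- The minimum cost of satisfying the covering constraints held by `S`. -/
noncomputable def coverOpt (N : Set (ℕ × ILPPart)) (S : Set ℕ) : ℝ≥0 :=
  sInf {z | ∃ X, CoversOn N S X ∧ costOf N X = z}

/-- `X` is optimal for the constraints held by `S`, and variables in no such constraint are `0`. -/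
def IsOptimalCover (N : Set (ℕ × ILPPart)) (S : Set ℕ) (X : ℕ → ℕ) : Prop :=
  CoversOn N S X ∧ costOf N X = coverOpt N S ∧
    ∀ i, X i ≠ 0 → ∃ p ∈ N, p.1 ∈ S ∧ ∃ c ∈ p.2.cons, i ∈ c.1.support

open Classical in
/-- An optimal cover for the constraints held by the outer cluster `D`. -/
noncomputable def coverSol (N : Set (ℕ × ILPPart)) (_C D : Set ℕ) : ℕ → ℕ :=
  if h : ∃ X, IsOptimalCover N D X then h.choose else 0

theorem coversOn_labelled {V : Type} {x : V → ILPPart} {ident : V → ℕ} (hi : ident.Injective)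
    {S T : Set V} (hST : S ⊆ T) {X : ℕ → ℕ} :
    CoversOn (labelled ident x T) (ident '' S) X ↔ ∀ v ∈ S, ∀ c ∈ (x v).cons, c.2 ≤ lhs c.1 X := by
  constructor
  · intro h v hv
    exact h _ ((mem_labelled_iff hi).mpr ⟨hST hv, rfl⟩) ⟨v, hv, rfl⟩
  · rintro h _ ⟨u, hu, rfl⟩ hS
    exact h u ((hi.mem_set_image).mp hS)

section Covering

variable {V : Type} [Fintype V] {G : SimpleGraph V} {x : V → ILPPart} {ident : V → ℕ}

/-- Optimal covers exist, and they are as good as the covers that may use all nodes. -/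
theorem exists_isOptimalCover (hi : ident.Injective) (hG : IsDistributed G x)
    (hfeas : ∃ X, CoveringFeasible x X) {S T : Set V} (hST : ∀ v ∈ S, hopBall G v 1 ⊆ T) :
    ∃ X, IsOptimalCover (labelled ident x T) (ident '' S) X ∧
      (∀ v ∈ S, ∀ c ∈ (x v).cons, c.2 ≤ lhs c.1 X) ∧
      objective x X = coverOpt (labelled ident x T) (ident '' S) ∧
      ∀ Y, (∀ v ∈ S, ∀ c ∈ (x v).cons, c.2 ≤ lhs c.1 Y) → objective x X ≤ objective x Y := by
  have hsub : S ⊆ T := fun v hv => hST v hv (mem_hopBall_self _ _)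
  obtain ⟨X, hX, hmin⟩ := exists_objective_minimal (x := x)
    (p := fun X => ∀ v ∈ S, ∀ c ∈ (x v).cons, c.2 ≤ lhs c.1 X)
    (hfeas.imp fun X hX v _ => hX v)
  -- Setting all other variables to 0 keeps the cover and does not raise its cost. The used ones are
  -- owned within distance 1 of `S`, hence in `T`, so the cost visible in `T` is then the whole
  -- objective.
  set used : ℕ → Prop := fun i => ∃ v ∈ S, ∃ c ∈ (x v).cons, i ∈ c.1.support with hused
  have hZ : ∀ Y, (∀ v ∈ S, ∀ c ∈ (x v).cons, c.2 ≤ lhs c.1 Y) →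
      ∀ v ∈ S, ∀ c ∈ (x v).cons, c.2 ≤ lhs c.1 (zeroOutside used Y) := by
    intro Y hY v hv c hc
    refine (hY v hv c hc).trans (le_of_eq (lhs_congr fun i hic => ?_))
    exact (zeroOutside_of_pos ⟨v, hv, c, hc, hic⟩).symm
  have howned : ∀ Y i, zeroOutside used Y i ≠ 0 → ∃ u ∈ T, i ∈ (x u).vars := by
    intro Y i hne
    by_cases hu : used i
    · obtain ⟨v, hv, c, hc, hic⟩ := hu
      obtain ⟨u, hu, hiu⟩ := hG.exists_mem_hopBall_one hc hic
      exact ⟨u, hST v hv hu, hiu⟩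
    · exact absurd (zeroOutside_of_neg hu) hne
  have hle : ∀ Y, costOf (labelled ident x T) (zeroOutside used Y) ≤
      costOf (labelled ident x T) Y := by
    intro Y
    classical
    rw [costOf_labelled hi, costOf_labelled hi]
    refine Finset.sum_le_sum fun v _ => ?_
    split_ifs
    · exact ILPPart.cost_mono fun i _ => zeroOutside_le _ _ _
    · exact le_rfl
  have hcost := fun Y => costOf_labelled_eq hi hG (howned Y)
  have hminZ : ∀ Y, (∀ v ∈ S, ∀ c ∈ (x v).cons, c.2 ≤ lhs c.1 Y) →
      objective x (zeroOutside used X) ≤ costOf (labelled ident x T) Y := by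
    intro Y hY
    calc objective x (zeroOutside used X) ≤ objective x X :=
          Finset.sum_le_sum fun v _ => ILPPart.cost_mono fun i _ => zeroOutside_le _ _ _
      _ ≤ objective x (zeroOutside used Y) := hmin _ (hZ Y hY)
      _ = costOf (labelled ident x T) (zeroOutside used Y) := (hcost Y).symm
      _ ≤ _ := hle Y
  have hopt : objective x (zeroOutside used X) = coverOpt (labelled ident x T) (ident '' S) := by
    have hleast : IsLeast {z | ∃ X, CoversOn (labelled ident x T) (ident '' S) X ∧
        costOf (labelled ident x T) X = z} (objective x (zeroOutside used X)) := by
      refine ⟨⟨zeroOutside used X, (coversOn_labelled hi hsub).mpr (hZ X hX), hcost X⟩, ?_⟩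
      rintro _ ⟨Y, hY, rfl⟩
      exact hminZ Y ((coversOn_labelled hi hsub).mp hY)
    exact hleast.csInf_eq.symm
  refine ⟨zeroOutside used X, ⟨(coversOn_labelled hi hsub).mpr (hZ X hX), (hcost X).trans hopt,
    fun i hne => ?_⟩, hZ X hX, hopt, fun Y hY => (hminZ Y hY).trans (costOf_labelled_le hi _ _)⟩
  by_cases hu : used i
  · obtain ⟨v, hv, c, hc, hic⟩ := hu
    exact ⟨_, ⟨v, hsub hv, rfl⟩, ⟨v, hv, rfl⟩, c, hc, hic⟩
  · exact absurd (zeroOutside_of_neg hu) hne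

/-- Both sides are the least objective value of a cover of `S`, however much of the network around
`S` is visible. -/
theorem coverOpt_eq (hi : ident.Injective) (hG : IsDistributed G x)
    (hfeas : ∃ X, CoveringFeasible x X) {S T : Set V} (hST : ∀ v ∈ S, hopBall G v 1 ⊆ T) :
    coverOpt (labelled ident x T) (ident '' S) =
      coverOpt (labelled ident x Set.univ) (ident '' S) := by
  obtain ⟨X, -, h₁, h₂, h₃⟩ := exists_isOptimalCover hi hG hfeas hST
  obtain ⟨Y, -, h₄, h₅, h₆⟩ := exists_isOptimalCover hi hG hfeas (T := Set.univ)
    fun v (_ : v ∈ S) => Set.subset_univ _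
  rw [← h₂, ← h₅]
  exact le_antisymm (h₃ Y h₄) (h₆ X h₁)

theorem coverSol_spec (hi : ident.Injective) (hG : IsDistributed G x)
    (hfeas : ∃ X, CoveringFeasible x X) {S T : Set V} (hST : ∀ v ∈ S, hopBall G v 1 ⊆ T)
    (C : Set ℕ) :
    (∀ v ∈ S, ∀ c ∈ (x v).cons, c.2 ≤ lhs c.1 (coverSol (labelled ident x T) C (ident '' S))) ∧
    objective x (coverSol (labelled ident x T) C (ident '' S)) =
      coverOpt (labelled ident x Set.univ) (ident '' S) ∧
    ∀ i, coverSol (labelled ident x T) C (ident '' S) i ≠ 0 →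
      ∃ v ∈ S, ∃ u ∈ hopBall G v 1, i ∈ (x u).vars := by
  have hsub : S ⊆ T := fun v hv => hST v hv (mem_hopBall_self _ _)
  have hex : ∃ X, IsOptimalCover (labelled ident x T) (ident '' S) X := by
    obtain ⟨X, hX, -⟩ := exists_isOptimalCover hi hG hfeas hST
    exact ⟨X, hX⟩
  have hsol : coverSol (labelled ident x T) C (ident '' S) = hex.choose := dif_pos hex
  obtain ⟨h₁, h₂, h₃⟩ := hex.choose_spec
  rw [← hsol] at h₁ h₂ h₃
  have hused : ∀ i, coverSol (labelled ident x T) C (ident '' S) i ≠ 0 →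
      ∃ v ∈ S, ∃ u ∈ hopBall G v 1, i ∈ (x u).vars := by
    intro i hne
    obtain ⟨_, ⟨v, hv, rfl⟩, hvS, c, hc, hic⟩ := h₃ i hne
    exact ⟨v, (hi.mem_set_image).mp hvS, hG.exists_mem_hopBall_one hc hic⟩
  refine ⟨(coversOn_labelled hi hsub).mp h₁, ?_, hused⟩
  rw [← coverOpt_eq hi hG hfeas hST, ← h₂]
  refine (costOf_labelled_eq hi hG fun i hne => ?_).symm
  obtain ⟨v, hv, u, hu, hiu⟩ := hused i hne
  exact ⟨u, hST v hv hu, hiu⟩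

/-- Covering optima of sets at pairwise distance greater than 2 add up to at most the cost of any
feasible solution. -/
theorem sum_coverOpt_le (hi : ident.Injective) (hG : IsDistributed G x)
    (hfeas : ∃ X, CoveringFeasible x X) {C : V → Set V}
    (hC : ∀ {u v c c'}, c ∈ C u → c' ∈ C v → c' ∈ hopBall G c 2 → u = v) {X : ℕ → ℕ}
    (hX : CoveringFeasible x X) :
    ∑ u, coverOpt (labelled ident x Set.univ) (ident '' C u) ≤ objective x X := by
  classical
  -- `T u` contains the owners of all variables in constraints of `C u`, so `X` restricted to `T u`
  -- still covers `C u`. By separation the sets `T u` are disjoint.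
  obtain ⟨T, hT⟩ : ∃ T : V → Set V, ∀ u w, w ∈ T u ↔ ∃ c ∈ C u, w ∈ hopBall G c 1 :=
    ⟨fun u => {w | ∃ c ∈ C u, w ∈ hopBall G c 1}, fun _ _ => Iff.rfl⟩
  have h1 : ∀ u, coverOpt (labelled ident x Set.univ) (ident '' C u) ≤
      ∑ w, if w ∈ T u then (x w).cost X else 0 := by
    intro u
    obtain ⟨Y, -, -, hY, hmin⟩ := exists_isOptimalCover hi hG hfeas (T := Set.univ)
      fun v (_ : v ∈ C u) => Set.subset_univ _
    rw [← hY, ← objective_zeroOutside hG]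
    refine hmin _ fun v hv c hc => (hX v c hc).trans (le_of_eq (lhs_congr fun i hic => ?_))
    obtain ⟨w, hw, hiw⟩ := hG.exists_mem_hopBall_one hc hic
    exact (zeroOutside_of_pos ⟨w, (hT u w).mpr ⟨v, hv, hw⟩, hiw⟩).symm
  refine (Finset.sum_le_sum fun u _ => h1 u).trans ?_
  rw [Finset.sum_comm, objective_eq_sum_cost]
  refine Finset.sum_le_sum fun w _ => ?_
  by_cases hw : ∃ u, w ∈ T u
  · obtain ⟨u, hu⟩ := hw
    rw [Finset.sum_eq_single u, if_pos hu]
    · intro u' _ hne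
      refine if_neg fun hu' => hne ?_
      obtain ⟨c, hc, hcw⟩ := (hT _ _).mp hu
      obtain ⟨c', hc', hcw'⟩ := (hT _ _).mp hu'
      exact hC hc' hc (mem_hopBall_trans hcw' (mem_hopBall_comm.mp hcw))
    · simp
  · push Not at hw
    simp [hw]

end Covering

theorem coveringILP_mem_SLOCAL (α W : ℕ → ℝ≥0) (Q L : ℕ → ℕ)
    (hα : ∀ n, 1 + 2 / (Q n : ℝ≥0) ≤ α n)
    (hL : ∀ n : ℕ, (n : ℝ≥0) ≤ 1 / (Q n : ℝ≥0) * (1 + 1 / (Q n : ℝ≥0)) ^ L n) :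
    coveringILP α W ∈ SLOCAL (fun n => 4 * L n + 3) := by
  classical
  refine ⟨ClusterMemory, clusterAlg coverOpt coverSol (fun n => 1 + 1 / (Q n : ℝ≥0)) L, ?_⟩
  rintro V _ G x ⟨hG, -, hfeas⟩ ident hi order hnodup horder
  obtain ⟨C, D, y, hcl, hrun, hgrow, hy⟩ := clusterAlg_spec coverOpt coverSol
    (fun n => 1 + 1 / (Q n : ℝ≥0)) L G x ident hi order hnodup horder rfl rfl
  refine ⟨y, hrun, ?_⟩
  set n := Fintype.card V with hn
  set r := 4 * L n + 3 with hr
  set F : Set V → ℝ≥0 := fun S => coverOpt (labelled ident x Set.univ) (ident '' S) with hF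
  set Z : V → ℕ → ℕ := fun u =>
    coverSol (labelled ident x (hopBall G u r)) (ident '' C u) (ident '' D u) with hZ
  have hreach : ∀ u, ∀ S ⊆ hopBall G u (2 * L n + 1), ∀ v ∈ S, hopBall G v 1 ⊆ hopBall G u r :=
    fun u S hS v hv w hw => hopBall_mono _ (by omega) (mem_hopBall_trans (hS hv) hw)
  have hopt : ∀ u, ∀ S ⊆ hopBall G u (2 * L n + 1),
      coverOpt (labelled ident x (hopBall G u r)) (ident '' S) = F S := fun u S hS =>
    coverOpt_eq hi hG hfeas (hreach u S hS)
  have hZspec := fun u => coverSol_spec hi hG hfeas (hreach u (D u) (hcl.subset_hopBall u))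
    (ident '' C u)
  have hassign : ∀ v, ∀ i ∈ (x v).vars, assignment x y i = ∑ u, Z u i := by
    intro v i hiv
    rw [assignment_eq hG y hiv]
    -- A nonzero value stems from a constraint held in `D u` by `v`, the owner of `i`, or by a
    -- neighbor of `v`.
    refine hy v i fun u hne => ?_
    obtain ⟨w, hw, z, hz, hiz⟩ := (hZspec u).2.2 i hne
    obtain rfl := hG.owner_unique _ _ _ hiz hiv
    exact ⟨w, hw, mem_hopBall_comm.mp hz⟩
  refine ⟨fun v c hc => ?_, fun X hX => ?_⟩
  · obtain ⟨u, hu⟩ := hcl.exists_mem v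
    -- The cluster of `v` satisfies the constraint alone; the other clusters can only increase the
    -- left-hand side.
    refine ((hZspec u).1 v hu c hc).trans (lhs_mono fun i hic => ?_)
    obtain ⟨w, -, hiw⟩ := hG.exists_mem_hopBall_one hc hic
    rw [hassign w i hiw]
    exact Finset.single_le_sum (f := fun u => Z u i) (fun _ _ => Nat.zero_le _) (Finset.mem_univ u)
  · have hcost : objective x (assignment x y) = ∑ u, F (D u) := by
      calc objective x (assignment x y) = objective x (fun i => ∑ u, Z u i) :=
            Finset.sum_congr rfl fun v _ => ILPPart.cost_congr fun i hiv => hassign v i hiv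
        _ = ∑ u, objective x (Z u) := objective_sum x _ Z
        _ = _ := Finset.sum_congr rfl fun u _ => (hZspec u).2.1
    have hFle : ∀ S, F S ≤ objective x X := by
      intro S
      obtain ⟨Y, -, -, hY, hmin⟩ := exists_isOptimalCover hi hG hfeas (T := Set.univ)
        fun v (_ : v ∈ S) => Set.subset_univ _
      simp only [hF]
      rw [← hY]
      exact hmin X fun v _ => hX v
    have hsum := sum_clusters_le F C D hFle (a := 1 + 1 / (Q n : ℝ≥0)) (by positivity) (hL n)
      fun v => by
        have hg := hgrow v
        rw [hopt v _ (hcl.subset_hopBall v),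
          hopt v _ ((hcl.subset v).trans (hcl.subset_hopBall v))] at hg
        refine hg.imp id fun ⟨h₁, S, hS, h₂⟩ => ⟨h₁, S, ?_⟩
        rwa [hopt v _ hS] at h₂
    rw [hcost]
    calc ∑ u, F (D u) ≤ (1 + 1 / (Q n : ℝ≥0)) * ∑ u, F (C u) + 1 / (Q n : ℝ≥0) * objective x X :=
          hsum
      _ ≤ (1 + 1 / (Q n : ℝ≥0)) * objective x X + 1 / (Q n : ℝ≥0) * objective x X := by
          gcongr
          exact sum_coverOpt_le hi hG hfeas hcl.eq_of_mem_hopBall hX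
      _ = (1 + 2 / (Q n : ℝ≥0)) * objective x X := by ring
      _ ≤ _ := mul_le_mul_left (hα n) _

/-! ### Packing integer linear programs -/

/-- `X` satisfies all packing constraints, and its nonzero variables belong to `S`. -/
def PacksIn (N : Set (ℕ × ILPPart)) (S : Set ℕ) (X : ℕ → ℕ) : Prop :=
  (∀ p ∈ N, ∀ c ∈ p.2.cons, lhs c.1 X ≤ c.2) ∧ ∀ i, X i ≠ 0 → ∃ p ∈ N, p.1 ∈ S ∧ i ∈ p.2.vars

/-- The maximum value of a packing with the variables of `S`. -/
noncomputable def packOpt (N : Set (ℕ × ILPPart)) (S : Set ℕ) : ℝ≥0 :=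
  sSup {z | ∃ X, PacksIn N S X ∧ costOf N X = z}

open Classical in
/-- An optimal packing with the variables of the inner cluster `C`. -/
noncomputable def packSol (N : Set (ℕ × ILPPart)) (C _D : Set ℕ) : ℕ → ℕ :=
  if h : ∃ X, PacksIn N C X ∧ costOf N X = packOpt N C then h.choose else 0

/-- Constraints held outside `T` contain no variable of `S`, so their left-hand sides vanish and
local feasibility is global. -/
theorem packsIn_labelled {V : Type} {G : SimpleGraph V} {x : V → ILPPart} {ident : V → ℕ}
    (hi : ident.Injective) (hG : IsDistributed G x) {S T : Set V}
    (hST : ∀ v ∈ S, hopBall G v 1 ⊆ T) {X : ℕ → ℕ} :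
    PacksIn (labelled ident x T) (ident '' S) X ↔
      PackingFeasible x X ∧ ∀ i, X i ≠ 0 → ∃ v ∈ S, i ∈ (x v).vars := by
  have hsub : S ⊆ T := fun v hv => hST v hv (mem_hopBall_self _ _)
  constructor
  · rintro ⟨h₁, h₂⟩
    have h₃ : ∀ i, X i ≠ 0 → ∃ v ∈ S, i ∈ (x v).vars := by
      intro i hne
      obtain ⟨_, ⟨v, hv, rfl⟩, hvS, hiv⟩ := h₂ i hne
      exact ⟨v, (hi.mem_set_image).mp hvS, hiv⟩
    refine ⟨fun w c hc => ?_, h₃⟩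
    by_cases hw : w ∈ T
    · exact h₁ _ ⟨w, hw, rfl⟩ c hc
    · have : lhs c.1 X = 0 := Finset.sum_eq_zero fun i hic => by
        have hXi : X i = 0 := by
          by_contra hne
          obtain ⟨v, hv, hiv⟩ := h₃ i hne
          obtain ⟨u, hu, hiu⟩ := hG.exists_mem_hopBall_one hc hic
          obtain rfl := hG.owner_unique _ _ _ hiu hiv
          exact hw (hST _ hv (mem_hopBall_comm.mp hu))
        rw [hXi, Nat.cast_zero, mul_zero]
      rw [this]
      exact zero_le
  · rintro ⟨h₁, h₂⟩
    refine ⟨?_, fun i hne => ?_⟩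
    · rintro _ ⟨u, hu, rfl⟩
      exact h₁ u
    · obtain ⟨v, hv, hiv⟩ := h₂ i hne
      exact ⟨_, ⟨v, hsub hv, rfl⟩, ⟨v, hv, rfl⟩, hiv⟩

section Packing

variable {V : Type} [Fintype V] {G : SimpleGraph V} {x : V → ILPPart} {ident : V → ℕ}

/-- Visible and global solutions have the same values. The maximum is attained: the zero packing is
feasible, and a bounded objective takes only finitely many values. -/
theorem isGreatest_packOpt (hi : ident.Injective) (hG : IsDistributed G x)
    (hbdd : BddAbove (objective x '' {X | PackingFeasible x X})) {S T : Set V}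
    (hST : ∀ v ∈ S, hopBall G v 1 ⊆ T) :
    IsGreatest {z | ∃ X, PacksIn (labelled ident x T) (ident '' S) X ∧
        costOf (labelled ident x T) X = z} (packOpt (labelled ident x T) (ident '' S)) ∧
    IsGreatest {z | ∃ X, (PackingFeasible x X ∧ ∀ i, X i ≠ 0 → ∃ v ∈ S, i ∈ (x v).vars) ∧
        objective x X = z} (packOpt (labelled ident x T) (ident '' S)) := by
  have hsub : S ⊆ T := fun v hv => hST v hv (mem_hopBall_self _ _)
  have hset : {z | ∃ X, PacksIn (labelled ident x T) (ident '' S) X ∧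
        costOf (labelled ident x T) X = z} =
      {z | ∃ X, (PackingFeasible x X ∧ ∀ i, X i ≠ 0 → ∃ v ∈ S, i ∈ (x v).vars) ∧
        objective x X = z} := by
    ext z
    refine exists_congr fun X => ?_
    rw [packsIn_labelled hi hG hST]
    refine and_congr_right fun hX => ?_
    rw [costOf_labelled_eq hi hG fun i hne => ?_]
    obtain ⟨v, hv, hiv⟩ := hX.2 i hne
    exact ⟨v, hsub hv, hiv⟩
  rw [← hset, and_self, packOpt, hset]
  obtain ⟨M, hM⟩ := hbdd
  obtain ⟨X, hX, hmax⟩ := exists_objective_maximal (x := x)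
    (p := fun X => PackingFeasible x X ∧ ∀ i, X i ≠ 0 → ∃ v ∈ S, i ∈ (x v).vars)
    ⟨0, fun v c _ => by simp [lhs], fun i h => absurd rfl h⟩ (fun X hX => hM ⟨X, hX.1, rfl⟩)
  have hgr : IsGreatest {z | ∃ X, (PackingFeasible x X ∧ ∀ i, X i ≠ 0 → ∃ v ∈ S, i ∈ (x v).vars) ∧
      objective x X = z} (objective x X) := by
    refine ⟨⟨X, hX, rfl⟩, ?_⟩
    rintro _ ⟨Y, hY, rfl⟩
    exact hmax Y hY
  rwa [hgr.csSup_eq]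

theorem packOpt_eq (hi : ident.Injective) (hG : IsDistributed G x)
    (hbdd : BddAbove (objective x '' {X | PackingFeasible x X})) {S T : Set V}
    (hST : ∀ v ∈ S, hopBall G v 1 ⊆ T) :
    packOpt (labelled ident x T) (ident '' S) =
      packOpt (labelled ident x Set.univ) (ident '' S) :=
  (isGreatest_packOpt hi hG hbdd hST).2.unique
    (isGreatest_packOpt hi hG hbdd fun _ _ => Set.subset_univ _).2

theorem packSol_spec (hi : ident.Injective) (hG : IsDistributed G x)
    (hbdd : BddAbove (objective x '' {X | PackingFeasible x X})) {S T : Set V}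
    (hST : ∀ v ∈ S, hopBall G v 1 ⊆ T) (D : Set ℕ) :
    PackingFeasible x (packSol (labelled ident x T) (ident '' S) D) ∧
    objective x (packSol (labelled ident x T) (ident '' S) D) =
      packOpt (labelled ident x Set.univ) (ident '' S) ∧
    ∀ i, packSol (labelled ident x T) (ident '' S) D i ≠ 0 → ∃ v ∈ S, i ∈ (x v).vars := by
  have hex := (isGreatest_packOpt (ident := ident) hi hG hbdd hST).1.1
  have hsol : packSol (labelled ident x T) (ident '' S) D = hex.choose := dif_pos hex
  obtain ⟨h₁, h₂⟩ := hex.choose_spec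
  rw [← hsol] at h₁ h₂
  have h₃ := (packsIn_labelled hi hG hST).mp h₁
  refine ⟨h₃.1, ?_, h₃.2⟩
  rw [← packOpt_eq hi hG hbdd hST, ← h₂]
  refine (costOf_labelled_eq hi hG fun i hne => ?_).symm
  obtain ⟨v, hv, hiv⟩ := h₃.2 i hne
  exact ⟨v, hST v hv (mem_hopBall_self _ _), hiv⟩

theorem objective_le_packOpt (hi : ident.Injective) (hG : IsDistributed G x)
    (hbdd : BddAbove (objective x '' {X | PackingFeasible x X})) {S : Set V} {X : ℕ → ℕ}
    (hX : PackingFeasible x X) (hS : ∀ i, X i ≠ 0 → ∃ v ∈ S, i ∈ (x v).vars) :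
    objective x X ≤ packOpt (labelled ident x Set.univ) (ident '' S) :=
  (isGreatest_packOpt hi hG hbdd fun _ _ => Set.subset_univ _).2.2 ⟨X, ⟨hX, hS⟩, rfl⟩

/-- The packing optima of sets that cover all nodes add up to at least the value of any packing. -/
theorem objective_le_sum_packOpt (hi : ident.Injective) (hG : IsDistributed G x)
    (hbdd : BddAbove (objective x '' {X | PackingFeasible x X})) {D : V → Set V}
    (hD : ∀ w, ∃ u, w ∈ D u) {X : ℕ → ℕ} (hX : PackingFeasible x X) :
    objective x X ≤ ∑ u, packOpt (labelled ident x Set.univ) (ident '' D u) := by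
  classical
  have h1 : ∀ u, (∑ w, if w ∈ D u then (x w).cost X else 0) ≤
      packOpt (labelled ident x Set.univ) (ident '' D u) := by
    intro u
    rw [← objective_zeroOutside hG]
    refine objective_le_packOpt hi hG hbdd
      (fun w c hc => (lhs_mono fun i _ => zeroOutside_le _ _ _).trans (hX w c hc)) fun i hne => ?_
    by_contra h
    exact hne (zeroOutside_of_neg h)
  refine le_trans ?_ (Finset.sum_le_sum fun u _ => h1 u)
  rw [Finset.sum_comm, objective_eq_sum_cost]
  refine Finset.sum_le_sum fun w _ => ?_
  obtain ⟨u, hu⟩ := hD w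
  calc (x w).cost X = if w ∈ D u then (x w).cost X else 0 := (if_pos hu).symm
    _ ≤ _ := Finset.single_le_sum (f := fun u => if w ∈ D u then (x w).cost X else 0)
        (fun _ _ => zero_le) (Finset.mem_univ u)

/-- Packings with variables of sets at pairwise distance greater than 2 add up to a packing. -/
theorem packingFeasible_sum (hG : IsDistributed G x) {C : V → Set V}
    (hC : ∀ {u v c c'}, c ∈ C u → c' ∈ C v → c' ∈ hopBall G c 2 → u = v) {Z : V → ℕ → ℕ}
    (hZ : ∀ u, PackingFeasible x (Z u)) (hs : ∀ u i, Z u i ≠ 0 → ∃ v ∈ C u, i ∈ (x v).vars) :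
    PackingFeasible x fun i => ∑ u, Z u i := by
  intro w c hc
  -- The owners of two variables of one constraint are within distance 2, so at most one `Z u` is
  -- nonzero on it, and the sum agrees with that `Z u`.
  by_cases h : ∃ u, ∃ i ∈ c.1.support, Z u i ≠ 0
  · obtain ⟨u, i, hic, hne⟩ := h
    refine le_trans (le_of_eq (lhs_congr fun j hjc => ?_)) (hZ u w c hc)
    refine Finset.sum_eq_single u (fun u' _ hu' => ?_) (by simp)
    by_contra hne'
    obtain ⟨v, hv, hiv⟩ := hs u i hne
    obtain ⟨v', hv', hjv⟩ := hs u' j hne'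
    obtain ⟨z, hz, hiz⟩ := hG.exists_mem_hopBall_one hc hic
    obtain ⟨z', hz', hjz⟩ := hG.exists_mem_hopBall_one hc hjc
    obtain rfl := hG.owner_unique _ _ _ hiz hiv
    obtain rfl := hG.owner_unique _ _ _ hjz hjv
    exact hu' (hC hv' hv (mem_hopBall_trans (mem_hopBall_comm.mp hz') hz))
  · push Not at h
    have : lhs c.1 (fun i => ∑ u, Z u i) = 0 := Finset.sum_eq_zero fun i hic => by
      have hz : ∑ u, Z u i = 0 := Finset.sum_eq_zero fun u _ => h u i hic
      simp only [hz, Nat.cast_zero, mul_zero]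
    rw [this]
    exact zero_le

end Packing

theorem packingILP_mem_SLOCAL (α W : ℕ → ℝ≥0) (Q L : ℕ → ℕ) (hQ : ∀ n, 2 ≤ Q n)
    (hα : ∀ n, 1 + 4 / (Q n : ℝ≥0) ≤ α n)
    (hL : ∀ n : ℕ, (n : ℝ≥0) ≤ 1 / (Q n : ℝ≥0) * (1 + 1 / (Q n : ℝ≥0)) ^ L n) :
    packingILP α W ∈ SLOCAL (fun n => 4 * L n + 3) := by
  classical
  refine ⟨ClusterMemory, clusterAlg packOpt packSol (fun n => 1 + 1 / (Q n : ℝ≥0)) L, ?_⟩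
  rintro V _ G x ⟨hG, -, hbdd⟩ ident hi order hnodup horder
  obtain ⟨C, D, y, hcl, hrun, hgrow, hy⟩ := clusterAlg_spec packOpt packSol
    (fun n => 1 + 1 / (Q n : ℝ≥0)) L G x ident hi order hnodup horder rfl rfl
  refine ⟨y, hrun, ?_⟩
  set n := Fintype.card V with hn
  set r := 4 * L n + 3 with hr
  set F : Set V → ℝ≥0 := fun S => packOpt (labelled ident x Set.univ) (ident '' S) with hF
  set Z : V → ℕ → ℕ := fun u =>
    packSol (labelled ident x (hopBall G u r)) (ident '' C u) (ident '' D u) with hZ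
  have hreach : ∀ u, ∀ S ⊆ hopBall G u (2 * L n + 1), ∀ v ∈ S, hopBall G v 1 ⊆ hopBall G u r :=
    fun u S hS v hv w hw => hopBall_mono _ (by omega) (mem_hopBall_trans (hS hv) hw)
  have hopt : ∀ u, ∀ S ⊆ hopBall G u (2 * L n + 1),
      packOpt (labelled ident x (hopBall G u r)) (ident '' S) = F S := fun u S hS =>
    packOpt_eq hi hG hbdd (hreach u S hS)
  have hZspec := fun u => packSol_spec hi hG hbdd
    (hreach u (C u) ((hcl.subset u).trans (hcl.subset_hopBall u))) (ident '' D u)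
  have hassign : ∀ v, ∀ i ∈ (x v).vars, assignment x y i = ∑ u, Z u i := by
    intro v i hiv
    rw [assignment_eq hG y hiv]
    refine hy v i fun u hne => ?_
    obtain ⟨w, hw, hiw⟩ := (hZspec u).2.2 i hne
    obtain rfl := hG.owner_unique _ _ _ hiw hiv
    exact ⟨w, hcl.subset u hw, mem_hopBall_self _ _⟩
  refine ⟨fun v c hc => ?_, fun X hX => ?_⟩
  · refine le_trans (le_of_eq (lhs_congr fun i hic => ?_))
      (packingFeasible_sum hG hcl.eq_of_mem_hopBall (fun u => (hZspec u).1)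
        (fun u => (hZspec u).2.2) v c hc)
    obtain ⟨w, -, hiw⟩ := hG.exists_mem_hopBall_one hc hic
    exact hassign w i hiw
  · have hcost : objective x (assignment x y) = ∑ u, F (C u) := by
      calc objective x (assignment x y) = objective x (fun i => ∑ u, Z u i) :=
            Finset.sum_congr rfl fun v _ => ILPPart.cost_congr fun i hiv => hassign v i hiv
        _ = ∑ u, objective x (Z u) := objective_sum x _ Z
        _ = _ := Finset.sum_congr rfl fun u _ => (hZspec u).2.1
    obtain ⟨M, hM⟩ := id hbdd
    -- An optimal `Y` replaces `X`: the same number must bound every `F S` from above and be bounded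
    -- by `∑ F (D u)`.
    obtain ⟨Y, hY, hmax⟩ := exists_objective_maximal (x := x) (p := PackingFeasible x) ⟨X, hX⟩
      (fun X hX => hM ⟨X, hX, rfl⟩)
    have hFle : ∀ S, F S ≤ objective x Y := by
      intro S
      obtain ⟨Y', hY', h⟩ := (isGreatest_packOpt (ident := ident) (S := S) hi hG hbdd
        fun _ _ => Set.subset_univ _).2.1
      simp only [hF]
      rw [← h]
      exact hmax Y' hY'.1
    have hsum := sum_clusters_le F C D hFle (a := 1 + 1 / (Q n : ℝ≥0)) (by positivity) (hL n)
      fun v => by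
        have hg := hgrow v
        rw [hopt v _ (hcl.subset_hopBall v),
          hopt v _ ((hcl.subset v).trans (hcl.subset_hopBall v))] at hg
        refine hg.imp id fun ⟨h₁, S, hS, h₂⟩ => ⟨h₁, S, ?_⟩
        rwa [hopt v _ hS] at h₂
    rw [hcost]
    have hYle := (objective_le_sum_packOpt (ident := ident) hi hG hbdd hcl.exists_mem hY).trans hsum
    refine (hmax X hX).trans (le_trans ?_ (mul_le_mul_left (hα n) _))
    generalize objective x Y = opt at hYle
    generalize ∑ u, F (C u) = alg at hYle
    rw [← NNReal.coe_le_coe] at hYle ⊢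
    push_cast at hYle ⊢
    have hQ' : (2 : ℝ) ≤ Q n := by exact_mod_cast hQ n
    set d : ℝ := 1 / (Q n : ℝ) with hd
    have hd0 : 0 < d := by positivity
    have hd2 : d ≤ 1 / 2 := one_div_le_one_div_of_le (by norm_num) hQ'
    have h4 : (4 : ℝ) / Q n = 4 * d := by rw [hd]; ring
    rw [h4]
    have halg : (0 : ℝ) ≤ alg := alg.2
    -- From `opt ≤ (1 + d) * alg + d * opt`. The constant 4 is justified by `1 + d ≤ (1 - d) * (1 +
    -- 4 * d)`, valid for `0 ≤ d ≤ 1/2`.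
    have h1 : (1 - d) * opt ≤ (1 - d) * ((1 + 4 * d) * alg) := by
      have : (1 + d) * alg ≤ (1 - d) * (1 + 4 * d) * (alg : ℝ) :=
        mul_le_mul_of_nonneg_right (by nlinarith) halg
      linarith
    exact le_of_mul_le_mul_left h1 (by linarith)

/-! ### Choice of parameters and conclusion. -/

/-- Bernoulli's inequality gives `(1 + 1/Q)^Q ≥ 2`, and `2 ^ (clog n + Q) ≥ n * Q`. -/
theorem le_pow_of_growth (n Q : ℕ) (hQ : 0 < Q) :
    (n : ℝ≥0) ≤ 1 / (Q : ℝ≥0) * (1 + 1 / (Q : ℝ≥0)) ^ (Q * (Nat.clog 2 n + Q)) := by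
  have hQ0 : (0 : ℝ) < Q := by exact_mod_cast hQ
  have h2 : (2 : ℝ) ≤ (1 + 1 / (Q : ℝ)) ^ Q := by
    have h0 : (0 : ℝ) ≤ 1 / (Q : ℝ) := by positivity
    have h := one_add_mul_le_pow (a := 1 / (Q : ℝ)) (by linarith) Q
    rwa [mul_one_div_cancel hQ0.ne', one_add_one_eq_two] at h
  rw [← NNReal.coe_le_coe]
  push_cast
  rw [div_mul_eq_mul_div, one_mul, le_div_iff₀ hQ0, pow_mul]
  calc (n : ℝ) * Q ≤ 2 ^ Nat.clog 2 n * 2 ^ Q := by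
        have h3 : n ≤ 2 ^ Nat.clog 2 n := Nat.le_pow_clog (by norm_num) n
        have h4 : Q ≤ 2 ^ Q := Nat.lt_two_pow_self.le
        exact_mod_cast Nat.mul_le_mul h3 h4
    _ = 2 ^ (Nat.clog 2 n + Q) := (pow_add _ _ _).symm
    _ ≤ _ := pow_le_pow_left₀ (by norm_num) h2 _

theorem mainTheorem7
    (q : ℕ → ℝ≥0) (hq_pos : ∀ n, 0 < q n) (hq : IsPolylog (fun n => (q n : ℝ)))
    (C k : ℕ) :
    (coveringILP (fun n => 1 + 1 / q n) (fun n => C * n ^ k) ∈ PSLOCAL ∧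
      packingILP (fun n => 1 + 1 / q n) (fun n => C * n ^ k) ∈ PSLOCAL) ∧
    ∀ c : ℝ, 0 < c →
      coveringILP (fun n => 1 + 1 / q n) (fun n => C * n ^ k) ∈
          PRLOCAL (fun n => 1 / (n : ℝ) ^ c) ∧
        packingILP (fun n => 1 + 1 / q n) (fun n => C * n ^ k) ∈
          PRLOCAL (fun n => 1 / (n : ℝ) ^ c) := by
  -- `4 * q ≤ Q` turns the loss `4 / Q` into `1 / q`; the summand 2 ensures `1 / Q ≤ 1/2`, as
  -- packing requires.
  set Q : ℕ → ℕ := fun n => ⌈4 * (q n : ℝ)⌉₊ + 2 with hQ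
  set L : ℕ → ℕ := fun n => Q n * (Nat.clog 2 n + Q n) with hL
  have hQpoly : IsPolylog fun n => (Q n : ℝ) :=
    isPolylog_of_le ((isPolylog_ceil ((isPolylog_const 4).mul hq fun n => (q n).2)
      fun n => by positivity).add (isPolylog_const 2)) fun n _ => by simp [hQ]
  have ht : IsPolylog fun n => ((4 * L n + 3 : ℕ) : ℝ) := by
    refine isPolylog_of_le (((isPolylog_const 4).mul (hQpoly.mul (isPolylog_clog.add hQpoly)
      fun n => by positivity) fun n => by positivity).add (isPolylog_const 3)) fun n _ => ?_
    simp only [hL]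
    push_cast
    rfl
  have hQ2 : ∀ n, 2 ≤ Q n := fun n => Nat.le_add_left _ _
  have hα4 : ∀ n, 1 + 4 / (Q n : ℝ≥0) ≤ 1 + 1 / q n := by
    intro n
    have hqn : (0 : ℝ) < q n := hq_pos n
    have h : 4 * (q n : ℝ) ≤ Q n := by
      have := Nat.le_ceil (4 * (q n : ℝ))
      simp only [hQ]
      push_cast
      linarith
    rw [← NNReal.coe_le_coe]
    push_cast
    have hQn : (0 : ℝ) < Q n := by linarith
    rw [add_le_add_iff_left, div_le_div_iff₀ hQn hqn]
    linarith
  have hα2 : ∀ n, 1 + 2 / (Q n : ℝ≥0) ≤ 1 + 1 / q n := fun n =>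
    le_trans (by gcongr; norm_num) (hα4 n)
  have hgrow := fun n => le_pow_of_growth n (Q n) (by have := hQ2 n; omega)
  have hc : coveringILP (fun n => 1 + 1 / q n) (fun n => C * n ^ k) ∈ PSLOCAL :=
    ⟨_, ht, coveringILP_mem_SLOCAL _ _ Q L hα2 hgrow⟩
  have hp : packingILP (fun n => 1 + 1 / q n) (fun n => C * n ^ k) ∈ PSLOCAL :=
    ⟨_, ht, packingILP_mem_SLOCAL _ _ Q L hQ2 hα4 hgrow⟩
  exact ⟨⟨hc, hp⟩, fun c hc0 =>
    ⟨mem_PRLOCAL_of_mem_PSLOCAL hc hc0, mem_PRLOCAL_of_mem_PSLOCAL hp hc0⟩⟩
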